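/- **Setting.** Fix finite sets of qubit names and of variables. The signal names are $s_i$ ($i$ a qubit, bound by the measurement of $i$) and the variables; a signal is a finite sum mod 2 of $0$, $1$ and signal names. A *pattern* $\mathcal P(V,I,O,\mathcal A)$ of the measurement calculus has a computation space $V\supseteq I$, inputs $I$, outputs $O$ and a finite sequence $\mathcal A$ of commands: entanglement $E_{ij}$ (controlled-$Z$, $i\ne j$), corrections $X_i^s$, $Z_i^s$, and destructive measurements ${}^t[M_i^\alpha]^s$ of qubit $i$ in the basis $|\pm_\beta\rangle=(|0\rangle\pm e^{i\beta}|1\rangle)/\sqrt2$ with $\beta=(-1)^s\alpha+t\pi$, whose outcome ($0$ for $+$, $1$ for $-$) is bound to $s_i$. The qubits in $V\setminus I$ are prepared in $|+\rangle$, commands act on qubits that are still present and use bound signals only, and the qubits left at the end are $O$. An *agent* $\mathbf A(i,o):Q.\mathcal E$ has classical inputs $i$ and outputs $o$ (finite sets of signal names), a set $Q$ of owned qubits and a finite program $\mathcal E$ of patterns, classical receptions $c?x$ and sendings $c!s$, and quantum receptions $c?q$ and sendings $c!q$ on channels $c$. A *network* $\mathcal N=|_a\mathbf A_a(i_a,o_a):Q_a.\mathcal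 E_a\,\|\,\sigma$ consists of finitely many agents and a shared resource, a density operator $\sigma$ of a set $R$ of qubits. **Small steps.** An agent may execute the pattern that comes next in its program if it owns the pattern's inputs (its type becomes $(Q\setminus I)\cup O$); two different agents whose next events are a sending and the corresponding reception on the same channel may execute both (a classical value is bound in the receiver's local memory; a qubit, which the sender must own, moves between their types). A local step applies an operator $L$ to the global quantum state, $\rho\mapsto L\rho L^\dagger$, with probability $\mathrm{tr}(L\rho L^\dagger)/\mathrm{tr}\,\rho$; communication does not change the quantum state. **Definiteness.** A network is *well-defined* if $R\subseteq\bigcup_aQ_a$; the $Q_a$ are pairwise disjoint; no name is given twice (the sets $V\setminus I$ of all patterns in the network are pairwise disjoint and disjoint from all $Q_a$); each channel is used by at most two agents; and for all values of the classical inputs and all measurement outcomes every reachable configuration can make a step or is terminal (all programs are finished) with a value for every classical output. **Semantics.** The *type signature* of $\mathcal N$ maps the quantum inputs $Q_a\setminus R$ to the finally owned qubits, and $i_a$ to $o_a$, for each agent $a$. For an input state (values of the classical inputs and a density operator $\rho$ of the quantum inputs) all agents start from their inputs and the global state $\rho\otimes\sigma$; a branch of the computation is given by the outcomes of all measurements of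 the network; within a branch the order of execution is chosen arbitrarily. The *operational semantics* is the type signature with the probabilistic transition system (PTS) in which an input state leads to a final state (classical output values and normalised quantum state) with the total probability of the branches leading there. The *denotational semantics* is the type signature with the completely positive maps (CPMs), one for each pair of classical inputs $\kappa$ and outputs $\kappa'$, $\rho\mapsto\sum K(\rho\otimes\sigma)K^\dagger$, the sum being over the branches from $\kappa$ to $\kappa'$, with $K$ the product of the operators of the branch. **Compositions.** $\mathcal N_2\circ\mathcal N_1$ is formed for networks of the same agents such that for each agent the quantum and classical outputs in $\mathcal N_1$ are the inputs in $\mathcal N_2$, the only qubit names common to both networks are outputs of $\mathcal N_1$, and each channel is used by at most two agents in both networks together. Each agent runs its program of $\mathcal N_1$ and then that of $\mathcal N_2$, and it owns from the start also its resource qubits of $\mathcal N_2$; the resource is $\sigma_1\otimes\sigma_2$. $\mathcal N_1\otimes\mathcal N_2$ is formed for networks of different agents without common qubit names and channels; it consists of all agents of both, with the resource $\sigma_1\otimes\sigma_2$. **Proposition.** The semantics of networks is compositional. Let $\mathcal N_1,\mathcal N_2$ be well-defined networks. 1. If $\mathcal N_2\circ\mathcal N_1$ can be formed, then it is well-defined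 and $[\![\mathcal N_2\circ\mathcal N_1]\!]=[\![\mathcal N_2]\!]\circ[\![\mathcal N_1]\!]$, for the operational and for the denotational semantics. That is, the type signatures compose; the PTS of $\mathcal N_2\circ\mathcal N_1$ assigns to the transition from $s$ to $u$ the probability $\sum_t p_1(s,t)\,p_2(t,u)$; and the CPM of $\mathcal N_2\circ\mathcal N_1$ from $\kappa$ to $\kappa''$ is $\sum_{\kappa'}[\![\mathcal N_2]\!]_{\kappa'\to\kappa''}\circ[\![\mathcal N_1]\!]_{\kappa\to\kappa'}$ (a completely positive map). 2. If $\mathcal N_1\otimes\mathcal N_2$ can be formed, then it is well-defined and $[\![\mathcal N_1\otimes\mathcal N_2]\!]=[\![\mathcal N_1]\!]\otimes[\![\mathcal N_2]\!]$, for the operational and for the denotational semantics. That is, the type signatures are juxtaposed; on independent inputs $s_1\otimes s_2$ the PTS of $\mathcal N_1\otimes\mathcal N_2$ is the independent product of those of $\mathcal N_1$ and $\mathcal N_2$ (the transitions from $s_1$ to $t_1$ and from $s_2$ to $t_2$ contribute $p_1(s_1,t_1)\,p_2(s_2,t_2)$ to the one from $s_1\otimes s_2$ to $t_1\otimes t_2$);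 and the CPM from $(\kappa_1,\kappa_2)$ to $(\kappa_1',\kappa_2')$ is $[\![\mathcal N_1]\!]_{\kappa_1\to\kappa_1'}\otimes[\![\mathcal N_2]\!]_{\kappa_2\to\kappa_2'}$ on all inputs (a completely positive map). -/

import Mathlib

open Matrix
open scoped ComplexOrder

namespace DMC

section Quantum

variable {Q : Type*} [DecidableEq Q]

/-- Operators on qubit registers.  `Q` is the finite set of qubit names; the computational basis
vector of a register `S ⊆ Q` in which exactly the qubits in `b ⊆ S` have value `1` is labelled
by `b`, so that the basis of the register `S` is the set of subsets of `S`.  An operator from the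
register `S` to the register `T` is a matrix whose entries vanish outside `b ⊆ T`, `c ⊆ S`. -/
abbrev QOp (Q : Type*) : Type _ := Matrix (Finset Q) (Finset Q) ℂ

/-- `K` is an operator from the register `S` to the register `T`. -/
def IsOpFromTo (S T : Finset Q) (K : QOp Q) : Prop :=
  ∀ b c, K b c ≠ 0 → b ⊆ T ∧ c ⊆ S

/-- `ρ` is a density operator on the register `S`. -/
def IsDensity [Fintype Q] (S : Finset Q) (ρ : QOp Q) : Prop :=
  ρ.PosSemidef ∧ ρ.trace = 1 ∧ IsOpFromTo S S ρ

/-- The tensor product of an operator on the register `S` and one on a disjoint register `T`. -/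
def tensor (S T : Finset Q) (ρ σ : QOp Q) : QOp Q :=
  Matrix.of fun b c =>
    if b ⊆ S ∪ T ∧ c ⊆ S ∪ T then ρ (b ∩ S) (c ∩ S) * σ (b ∩ T) (c ∩ T) else 0

theorem tensor_add_left (S T : Finset Q) (ρ ρ' σ : QOp Q) :
    tensor S T (ρ + ρ') σ = tensor S T ρ σ + tensor S T ρ' σ := by
  ext b c
  simp only [tensor, Matrix.of_apply, Matrix.add_apply]
  split_ifs <;> ring

theorem tensor_smul_left (S T : Finset Q) (z : ℂ) (ρ σ : QOp Q) :
    tensor S T (z • ρ) σ = z • tensor S T ρ σ := by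
  ext b c
  simp only [tensor, Matrix.of_apply, Matrix.smul_apply, smul_eq_mul]
  split_ifs <;> ring

/-- The controlled-`Z` operator on the qubits `i` and `j`. -/
def ctrlZ (i j : Q) : QOp Q :=
  Matrix.diagonal fun b => if i ∈ b ∧ j ∈ b then -1 else 1

/-- The Pauli operator `X` on the qubit `i`. -/
def pauliX (i : Q) : QOp Q :=
  Matrix.of fun b c => if b = symmDiff c {i} then 1 else 0

/-- The Pauli operator `Z` on the qubit `i`. -/
def pauliZ (i : Q) : QOp Q :=
  Matrix.diagonal fun b => if i ∈ b then -1 else 1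

/-- The destructive projection `⟨+_β|` (for `v = false`) or `⟨-_β|` (for `v = true`) of the
qubit `i`, where `|±_β⟩ = (|0⟩ ± e^{iβ}|1⟩)/√2`.  It removes `i` from the register. -/
noncomputable def bra (i : Q) (β : ℝ) (v : Bool) : QOp Q :=
  Matrix.of fun b c =>
    if i ∈ b then 0
    else if c = b then 1 / (Real.sqrt 2 : ℂ)
    else if c = insert i b then
      (if v then -1 else 1) * Complex.exp (-(Complex.I * (β : ℂ))) / (Real.sqrt 2 : ℂ)
    else 0

/-- Preparation of the new qubits in `T`, each in the state `|+⟩ = (|0⟩ + |1⟩)/√2`. -/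
noncomputable def prep (T : Finset Q) : QOp Q :=
  Matrix.of fun b c => if b \ T = c then (1 / (Real.sqrt 2 : ℂ)) ^ T.card else 0

/-- `L` is a completely positive map from operators on the register `S` to operators on the
register `T`, that is, `L ρ = ∑ k, K k ρ (K k)†`; it ignores the entries of its argument that do
not belong to the register `S`. -/
def IsCPM [Fintype Q] (S T : Finset Q) (L : QOp Q →ₗ[ℂ] QOp Q) : Prop :=
  ∃ (n : ℕ) (K : Fin n → QOp Q), (∀ k, IsOpFromTo S T (K k)) ∧
    ∀ ρ, L ρ = ∑ k, K k * ρ * (K k)ᴴ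

/-- The tensor product of a linear map `L₁` from operators on `S₁` to operators on `T₁` and a
linear map `L₂` from operators on `S₂` to operators on `T₂`: it maps the matrix unit
`|b₁ ∪ b₂⟩⟨c₁ ∪ c₂|` to `L₁ |b₁⟩⟨c₁| ⊗ L₂ |b₂⟩⟨c₂|`. -/
noncomputable def mapTensor (S₁ T₁ S₂ T₂ : Finset Q) (L₁ L₂ : QOp Q →ₗ[ℂ] QOp Q)
    (ρ : QOp Q) : QOp Q :=
  ∑ b₁ ∈ S₁.powerset, ∑ c₁ ∈ S₁.powerset, ∑ b₂ ∈ S₂.powerset, ∑ c₂ ∈ S₂.powerset,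
    ρ (b₁ ∪ b₂) (c₁ ∪ c₂) •
      tensor T₁ T₂ (L₁ (Matrix.single b₁ c₁ 1)) (L₂ (Matrix.single b₂ c₂ 1))

end Quantum

section Programs

/-- Names of signals: `Sum.inl i` is the signal `s_i`, the outcome of the measurement of the
qubit `i`, and `Sum.inr x` is a variable (a message or an input). -/
abbrev Ref (Q X : Type*) : Type _ := Q ⊕ X

/-- Local memories (outcome maps): finite partial functions from signal names to bits. -/
abbrev Mem (Q X : Type*) : Type _ := Ref Q X → Option Bool

/-- Signals. -/
inductive Signal (Q X : Type*) where
  | zero : Signal Q X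
  | one : Signal Q X
  | ref : Ref Q X → Signal Q X
  | add : Signal Q X → Signal Q X → Signal Q X

/-- The value of a signal in a memory, undefined if a name without a binding occurs in it. -/
def Signal.eval {Q X : Type*} (Γ : Mem Q X) : Signal Q X → Option Bool
  | .zero => some false
  | .one => some true
  | .ref r => Γ r
  | .add s t => (s.eval Γ).bind fun v => (t.eval Γ).map fun u => xor v u

/-- Commands of the measurement calculus: entanglement, measurement of the qubit `i` with angle
`(-1)^s α + t π`, and conditional Pauli corrections. -/
inductive Cmd (Q X : Type*) where
  | E (i j : Q) : Cmd Q X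
  | M (α : ℝ) (i : Q) (s t : Signal Q X) : Cmd Q X
  | X (i : Q) (s : Signal Q X) : Cmd Q X
  | Z (i : Q) (s : Signal Q X) : Cmd Q X

/-- Patterns: computation space, inputs, outputs and command sequence.  All sequences are listed
in the order of their execution, so the head of the list is executed first. -/
structure Pattern (Q X : Type*) where
  V : Finset Q
  I : Finset Q
  O : Finset Q
  cmds : List (Cmd Q X)

/-- Events of agents: a pattern, or sending or receiving a signal or a qubit on a channel. -/
inductive Event (Q X Ch : Type*) where
  | pat (P : Pattern Q X) : Event Q X Ch
  | csend (c : Ch) (s : Signal Q X) : Event Q X Ch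
  | crecv (c : Ch) (x : Ref Q X) : Event Q X Ch
  | qsend (c : Ch) (q : Q) : Event Q X Ch
  | qrecv (c : Ch) (q : Q) : Event Q X Ch

/-- An agent: classical input and output names, type (the qubits it owns) and program. -/
structure Agent (Q X Ch : Type*) where
  cin : Finset (Ref Q X)
  cout : Finset (Ref Q X)
  own : Finset Q
  prog : List (Event Q X Ch)

/-- A network: one agent for each name in `A`, and a shared resource, which is a state `σ` of
the qubits in `res`.  The types of the agents include the resource qubits they hold. -/
structure Network (A Q X Ch : Type*) where
  ag : A → Agent Q X Ch
  res : Finset Q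
  σ : QOp Q

end Programs

section Semantics

variable {A Q X Ch : Type*} [Fintype A] [DecidableEq A] [Fintype Q] [DecidableEq Q]
  [Fintype X] [DecidableEq X]

/-- Execution of a command on the present qubits `W` of a pattern in the memory `Γ`, in the branch
of the computation where the qubits in `o` yield the measurement outcome `1` and all others
yield `0`.  The result is the operator applied to the quantum state, the qubits left and the
new memory; there is none if the command acts on an absent qubit or uses an unbound signal. -/
noncomputable def Cmd.exec (o W : Finset Q) (Γ : Mem Q X) :
    Cmd Q X → Option (QOp Q × Finset Q × Mem Q X)
  | .E i j => if i ∈ W ∧ j ∈ W ∧ i ≠ j then some (ctrlZ i j, W, Γ) else none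
  | .X i s =>
      if i ∈ W then (s.eval Γ).map fun v => (if v then pauliX i else 1, W, Γ) else none
  | .Z i s =>
      if i ∈ W then (s.eval Γ).map fun v => (if v then pauliZ i else 1, W, Γ) else none
  | .M α i s t =>
      if i ∈ W then
        (s.eval Γ).bind fun v => (t.eval Γ).map fun u =>
          (bra i ((if v then -α else α) + (if u then Real.pi else 0)) (decide (i ∈ o)),
            W.erase i, Function.update Γ (Sum.inl i) (some (decide (i ∈ o))))
      else none

/-- Execution of a command sequence. -/
noncomputable def execCmds (o : Finset Q) :
    List (Cmd Q X) → Finset Q → Mem Q X → Option (QOp Q × Finset Q × Mem Q X)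
  | [], W, Γ => some (1, W, Γ)
  | C :: cs, W, Γ =>
      (C.exec o W Γ).bind fun r =>
        (execCmds o cs r.2.1 r.2.2).map fun r' => (r'.1 * r.1, r'.2)

/-- Execution of a pattern: the qubits in `V \ I` are prepared, then the commands are executed;
the qubits that remain have to be the outputs. -/
noncomputable def Pattern.exec (o : Finset Q) (Γ : Mem Q X) (P : Pattern Q X) :
    Option (QOp Q × Mem Q X) :=
  if P.I ⊆ P.V then
    (execCmds o P.cmds P.V Γ).bind fun r =>
      if r.2.1 = P.O then some (r.1 * prep (P.V \ P.I), r.2.2) else none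
  else none

/-- The state of an agent during a computation: memory, owned qubits, remaining program. -/
structure AgentState (Q X Ch : Type*) where
  mem : Mem Q X
  own : Finset Q
  prog : List (Event Q X Ch)

/-- The small steps of a network in the branch of the computation with outcomes `o`.
`Step o c L c'` means that `c` moves to `c'` while the operator `L` acts on the global quantum
state.  The rules are: local execution of a pattern, exchange of a classical message, and
exchange of a qubit; each of them may fire in the context of a larger system. -/
inductive Step (o : Finset Q) :
    (A → AgentState Q X Ch) → QOp Q → (A → AgentState Q X Ch) → Prop
  | pat (c : A → AgentState Q X Ch) (a : A) (P : Pattern Q X) (es : List (Event Q X Ch))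
      (L : QOp Q) (Γ : Mem Q X) (hprog : (c a).prog = .pat P :: es) (hown : P.I ⊆ (c a).own)
      (hexec : P.exec o (c a).mem = some (L, Γ)) :
      Step o c L (Function.update c a ⟨Γ, ((c a).own \ P.I) ∪ P.O, es⟩)
  | ccom (c : A → AgentState Q X Ch) (a b : A) (hab : a ≠ b) (ch : Ch) (x : Ref Q X)
      (s : Signal Q X) (v : Bool) (es fs : List (Event Q X Ch))
      (ha : (c a).prog = .crecv ch x :: es) (hb : (c b).prog = .csend ch s :: fs)
      (hv : s.eval (c b).mem = some v) :
      Step o c 1 (Function.update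
        (Function.update c a ⟨Function.update (c a).mem x (some v), (c a).own, es⟩)
        b ⟨(c b).mem, (c b).own, fs⟩)
  | qcom (c : A → AgentState Q X Ch) (a b : A) (hab : a ≠ b) (ch : Ch) (q : Q)
      (es fs : List (Event Q X Ch))
      (ha : (c a).prog = .qrecv ch q :: es) (hb : (c b).prog = .qsend ch q :: fs)
      (hq : q ∈ (c b).own) :
      Step o c 1 (Function.update
        (Function.update c a ⟨(c a).mem, insert q (c a).own, es⟩)
        b ⟨(c b).mem, (c b).own.erase q, fs⟩)

/-- Computation paths, with the product of the operators along the path. -/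
inductive Path (o : Finset Q) :
    (A → AgentState Q X Ch) → QOp Q → (A → AgentState Q X Ch) → Prop
  | refl (c : A → AgentState Q X Ch) : Path o c 1 c
  | tail (c c' c'' : A → AgentState Q X Ch) (K L : QOp Q) (hp : Path o c K c')
      (hs : Step o c' L c'') : Path o c (L * K) c''

/-- Computation paths of configurations with a (not renormalised) quantum state, with the product
of the transition probabilities along the path: a step with operator `L` maps `ρ` to `L ρ L†`
and has the probability `tr (L ρ L†) / tr ρ`. -/
inductive OpPath (o : Finset Q) : QOp Q → (A → AgentState Q X Ch) → ℝ →
    QOp Q → (A → AgentState Q X Ch) → Prop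
  | refl (ρ : QOp Q) (c : A → AgentState Q X Ch) : OpPath o ρ c 1 ρ c
  | tail (ρ ρ' : QOp Q) (c c' c'' : A → AgentState Q X Ch) (p : ℝ) (L : QOp Q)
      (hp : OpPath o ρ c p ρ' c') (hs : Step o c' L c'') :
      OpPath o ρ c (p * ((L * ρ' * Lᴴ).trace.re / ρ'.trace.re)) (L * ρ' * Lᴴ) c''

/-- All agents have executed all their events. -/
def Terminal (c : A → AgentState Q X Ch) : Prop := ∀ a, (c a).prog = []

/-- The effect of an event on the type of the agent. -/
def Event.newOwn (S : Finset Q) : Event Q X Ch → Finset Q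
  | .pat P => (S \ P.I) ∪ P.O
  | .csend _ _ => S
  | .crecv _ _ => S
  | .qsend _ q => S.erase q
  | .qrecv _ q => insert q S

/-- The channel used by an event. -/
def Event.chan? : Event Q X Ch → Option Ch
  | .pat _ => none
  | .csend c _ => some c
  | .crecv c _ => some c
  | .qsend c _ => some c
  | .qrecv c _ => some c

/-- The computation space of an event. -/
def Event.space : Event Q X Ch → Finset Q
  | .pat P => P.V
  | _ => ∅

/-- The working qubits that an event prepares. -/
def Event.prepared : Event Q X Ch → Finset Q
  | .pat P => P.V \ P.I
  | _ => ∅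

/-- The qubits that an event measures. -/
def Event.measured : Event Q X Ch → Finset Q
  | .pat P => P.V \ P.O
  | _ => ∅

/-- The union of the sets attached to the events of a program. -/
def gather (f : Event Q X Ch → Finset Q) (es : List (Event Q X Ch)) : Finset Q :=
  es.foldr (fun e S => f e ∪ S) ∅

/-- Type signatures: for every agent its quantum inputs and outputs (without the shared resources)
and its classical inputs and outputs. -/
@[ext]
structure TypeSig (A Q X : Type*) where
  qin : A → Finset Q
  qout : A → Finset Q
  cin : A → Finset (Ref Q X)
  cout : A → Finset (Ref Q X)

/-- Functional composition of type signatures, to be used if the outputs of `t₁` are the inputs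
of `t₂`. -/
def TypeSig.comp (t₂ t₁ : TypeSig A Q X) : TypeSig A Q X :=
  ⟨t₁.qin, t₂.qout, t₁.cin, t₂.cout⟩

/-- Juxtaposition of type signatures. -/
def TypeSig.tensor {A₁ A₂ Q X : Type*} (t₁ : TypeSig A₁ Q X) (t₂ : TypeSig A₂ Q X) :
    TypeSig (A₁ ⊕ A₂) Q X :=
  ⟨Sum.elim t₁.qin t₂.qin, Sum.elim t₁.qout t₂.qout, Sum.elim t₁.cin t₂.cin,
    Sum.elim t₁.cout t₂.cout⟩

/-- States of the transition system of a network: classical values held by the agents and a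
quantum state. -/
abbrev PState (A Q X : Type*) : Type _ := (A → Mem Q X) × QOp Q

/-- Sequential composition of probabilistic transition systems: `(G ∘ F) s u = ∑ t, F s t G t u`.
A system assigns to every state the weights (with finite support) of its successors. -/
noncomputable def ptsComp (G F : PState A Q X → PState A Q X →₀ ℝ) :
    PState A Q X → PState A Q X →₀ ℝ :=
  fun s => (F s).sum fun t p => p • G t

/-- The product of two states on disjoint registers `S₁` and `S₂`. -/
def stateTensor {A₁ A₂ : Type*} (S₁ S₂ : Finset Q) (s₁ : PState A₁ Q X) (s₂ : PState A₂ Q X) :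
    PState (A₁ ⊕ A₂) Q X :=
  (Sum.elim s₁.1 s₂.1, tensor S₁ S₂ s₁.2 s₂.2)

/-- Independent product of two distributions: `t₁ ⊗ t₂` has the product of the weights. -/
noncomputable def distTensor {A₁ A₂ : Type*} (T₁ T₂ : Finset Q)
    (D₁ : PState A₁ Q X →₀ ℝ) (D₂ : PState A₂ Q X →₀ ℝ) : PState (A₁ ⊕ A₂) Q X →₀ ℝ :=
  D₁.sum fun t₁ p₁ => D₂.sum fun t₂ p₂ => Finsupp.single (stateTensor T₁ T₂ t₁ t₂) (p₁ * p₂)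

namespace Network

/-- The type signature of a network. -/
def sig (N : Network A Q X Ch) : TypeSig A Q X where
  qin a := (N.ag a).own \ N.res
  qout a := (N.ag a).prog.foldl (fun S e => e.newOwn S) (N.ag a).own
  cin a := (N.ag a).cin
  cout a := (N.ag a).cout

/-- All quantum inputs. -/
def inReg (N : Network A Q X Ch) : Finset Q := Finset.univ.biUnion N.sig.qin

/-- All quantum outputs. -/
def outReg (N : Network A Q X Ch) : Finset Q := Finset.univ.biUnion N.sig.qout

/-- All qubits that are measured in the network. -/
def meas (N : Network A Q X Ch) : Finset Q :=
  Finset.univ.biUnion fun a => gather Event.measured (N.ag a).prog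

/-- All qubit names of the network. -/
def names (N : Network A Q X Ch) : Finset Q :=
  Finset.univ.biUnion fun a => (N.ag a).own ∪ gather Event.space (N.ag a).prog

/-- The agent `a` communicates on the channel `ch`. -/
def Uses (N : Network A Q X Ch) (a : A) (ch : Ch) : Prop :=
  ∃ e ∈ (N.ag a).prog, e.chan? = some ch

/-- The initial configuration for the classical inputs `κ`. -/
def init (N : Network A Q X Ch) (κ : A → Mem Q X) : A → AgentState Q X Ch :=
  fun a => ⟨κ a, (N.ag a).own, (N.ag a).prog⟩

/-- `κ` assigns values exactly to the classical inputs. -/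
def ClassicalInput (N : Network A Q X Ch) (κ : A → Mem Q X) : Prop :=
  ∀ a r, (κ a r).isSome ↔ r ∈ (N.ag a).cin

/-- The values of the classical outputs. -/
def output (N : Network A Q X Ch) (c : A → AgentState Q X Ch) : A → Mem Q X :=
  fun a r => if r ∈ (N.ag a).cout then (c a).mem r else none

/-- The definiteness conditions.  The shared resource is a state of qubits held by the agents;
different agents own different qubits; no name is given to two qubits (initial qubits and
prepared working qubits); a channel joins at most two agents; and the computation does not
get stuck: in all branches, every reachable configuration has a successor or is terminal, and
in the latter case all classical outputs have values. -/
structure WellDefined (N : Network A Q X Ch) : Prop where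
  res_subset : ∀ q ∈ N.res, ∃ a, q ∈ (N.ag a).own
  density : IsDensity N.res N.σ
  own_disjoint : ∀ a b, a ≠ b → Disjoint (N.ag a).own (N.ag b).own
  prepared_new : ∀ a b, Disjoint (gather Event.prepared (N.ag a).prog) (N.ag b).own
  prepared_agents : ∀ a b, a ≠ b →
    Disjoint (gather Event.prepared (N.ag a).prog) (gather Event.prepared (N.ag b).prog)
  prepared_once : ∀ a, (N.ag a).prog.Pairwise fun e f => Disjoint e.prepared f.prepared
  channels : ∀ ch, {a | N.Uses a ch}.ncard ≤ 2
  progress : ∀ κ, N.ClassicalInput κ → ∀ o K c, Path o (N.init κ) K c →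
    (∃ L c', Step o c L c') ∨
      (Terminal c ∧ ∀ a, ∀ r ∈ (N.ag a).cout, ((c a).mem r).isSome)

/-- `K` is the operator of the branch with outcomes `o` of a complete computation from the
classical inputs `κ` to the classical outputs `κ'`. -/
def Branch (N : Network A Q X Ch) (κ : A → Mem Q X) (o : Finset Q) (K : QOp Q)
    (κ' : A → Mem Q X) : Prop :=
  N.ClassicalInput κ ∧ ∃ c, Path o (N.init κ) K c ∧ Terminal c ∧ κ' = N.output c

open Classical in
/-- The operator of a branch, for an arbitrarily chosen order of execution; it is `0` if the
classical outputs of the branch are not `κ'`. -/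
noncomputable def branchOp (N : Network A Q X Ch) (κ : A → Mem Q X) (o : Finset Q)
    (κ' : A → Mem Q X) : QOp Q :=
  if h : ∃ K, N.Branch κ o K κ' then h.choose else 0

/-- Denotational semantics (besides the type signature): for classical inputs `κ` and classical
outputs `κ'` the completely positive map that sends the input state `ρ` to the sum over all
branches of the output states `K (ρ ⊗ σ) K†`.  Without classical inputs and outputs this is a
single completely positive map. -/
noncomputable def den (N : Network A Q X Ch) (κ κ' : A → Mem Q X) : QOp Q →ₗ[ℂ] QOp Q where
  toFun ρ := ∑ o ∈ N.meas.powerset,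
    N.branchOp κ o κ' * tensor N.inReg N.res ρ N.σ * (N.branchOp κ o κ')ᴴ
  map_add' ρ ρ' := by
    simp only [tensor_add_left, Matrix.mul_add, Matrix.add_mul, Finset.sum_add_distrib]
  map_smul' z ρ := by
    simp only [tensor_smul_left, Matrix.mul_smul, Matrix.smul_mul, Finset.smul_sum,
      RingHom.id_apply]

/-- Input states of the network. -/
def IsInput (N : Network A Q X Ch) (s : PState A Q X) : Prop :=
  N.ClassicalInput s.1 ∧ IsDensity N.inReg s.2

/-- In the branch with outcomes `o`, a complete computation leads with probability `p` from the
input state `s` to the state `t`, whose quantum part is normalised here. -/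
def OpBranch (N : Network A Q X Ch) (s : PState A Q X) (o : Finset Q) (p : ℝ)
    (t : PState A Q X) : Prop :=
  N.IsInput s ∧ ∃ ρ c, OpPath o (tensor N.inReg N.res s.2 N.σ) (N.init s.1) p ρ c ∧
    Terminal c ∧ t = (N.output c, (ρ.trace)⁻¹ • ρ)

open Classical in
/-- Operational semantics (besides the type signature): the probabilistic transition system in
which every input state `s` makes a transition to each final state `t`, with the total
probability of the branches that lead from `s` to `t`.  The order of execution is chosen
arbitrarily in each branch. -/
noncomputable def ops (N : Network A Q X Ch) (s : PState A Q X) : PState A Q X →₀ ℝ :=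
  ∑ o ∈ N.meas.powerset,
    if h : ∃ pt : ℝ × PState A Q X, N.OpBranch s o pt.1 pt.2 then
      Finsupp.single h.choose.2 h.choose.1
    else 0

/-- Sequential composition `N₂ ∘ N₁`: every agent executes its program in `N₁` and then its
program in `N₂`, and both shared resources are present from the start. -/
def comp (N₂ N₁ : Network A Q X Ch) : Network A Q X Ch where
  ag a :=
    { cin := (N₁.ag a).cin
      cout := (N₂.ag a).cout
      own := (N₁.ag a).own ∪ ((N₂.ag a).own ∩ N₂.res)
      prog := (N₁.ag a).prog ++ (N₂.ag a).prog }
  res := N₁.res ∪ N₂.res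
  σ := DMC.tensor N₁.res N₂.res N₁.σ N₂.σ

/-- Parallel composition `N₁ ⊗ N₂` of networks of different agents. -/
def tensor {A₁ A₂ : Type*} (N₁ : Network A₁ Q X Ch) (N₂ : Network A₂ Q X Ch) :
    Network (A₁ ⊕ A₂) Q X Ch where
  ag := Sum.elim N₁.ag N₂.ag
  res := N₁.res ∪ N₂.res
  σ := DMC.tensor N₁.res N₂.res N₁.σ N₂.σ

/-- `N₂ ∘ N₁` is possible: for every agent the (quantum and classical) outputs in `N₁` are the
inputs in `N₂`, the networks have no other qubit names in common, and a channel still joins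
at most two agents. -/
structure SeqComposable (N₁ N₂ : Network A Q X Ch) : Prop where
  quantum : ∀ a, N₁.sig.qout a = N₂.sig.qin a
  classical : ∀ a, N₁.sig.cout a = N₂.sig.cin a
  names_inter : N₁.names ∩ N₂.names ⊆ N₁.outReg
  channels : ∀ ch, {a | N₁.Uses a ch ∨ N₂.Uses a ch}.ncard ≤ 2

/-- `N₁ ⊗ N₂` is possible: the networks have no qubit names and no channels in common. -/
structure ParComposable {A₁ A₂ : Type*} [Fintype A₁] [Fintype A₂]
    (N₁ : Network A₁ Q X Ch) (N₂ : Network A₂ Q X Ch) : Prop where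
  names_disjoint : Disjoint N₁.names N₂.names
  channels : ∀ ch a₁ a₂, ¬ (N₁.Uses a₁ ch ∧ N₂.Uses a₂ ch)

end Network

end Semantics

end DMC

/-!
The heart of the matter is that the arbitrary order of execution is harmless.  During a
computation the agents own pairwise disjoint sets of qubits, the qubits still to be prepared are
new, and a channel joins only two agents (`Sound`, an invariant by `Sound.step`).  Hence two
different steps enabled in the same configuration involve disjoint sets of agents: the next event
of an agent determines its step, including the partner of a communication
(`Sound.eq_of_common`).  Their operators act on disjoint sets of qubits and commute
(`LocalOn.commute`), which gives the diamond property `Sound.diamond`.  As every step shortens a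
program, it follows that one terminating computation in a branch suffices: every other one can be
continued to the same final configuration with the same total operator (`Sound.completes`).  So
the operator and the outputs of a branch are well defined, and to prove that a network makes
progress one only has to exhibit one terminating computation per branch (`Static.wellDefined`).

For `N₂ ∘ N₁` this computation runs `N₁` to its end and then `N₂`.  Both parts are obtained from
computations of the single networks by a simulation (`Extends.path`): larger memories, additional
qubits that are not named, and further events at the end of the programs do no harm.  A qubit that
is measured is never owned again (`Sound.not_present_of_measured`), so the two networks measure
different qubits and a branch of the composite network is a pair of branches.  The operator of `N₁`
does not touch the resource of `N₂` (`LocalOn.conj_tensor_left`), which gives the formula for the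
completely positive maps.  The transition probabilities along a path multiply to the trace of the
final unnormalised state (`OpPath.exists_path`), so that a branch contributes the normalised final
state weighted with that trace (`weightedPoint`), and the operational semantics composes by the
same computation.

For `N₁ ⊗ N₂` the two computations run side by side, and the operators of the two networks act on
the two factors of a product state (`conj_tensor`).  Since the matrix units of a composite register
are products, this determines the map on all inputs.  Complete positivity follows in both cases
from a decomposition `σ = BᴴB` of the shared resource (`tensor_eq_sum_adjoin`).
-/

namespace DMC

/-! ### Operators on some of the qubits -/

section Operators

variable {Q : Type*} [DecidableEq Q]

/-- `K` acts on the qubits in `S` only: it is of the form `K' ⊗ 1`, where `1` is the identity of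
all qubits outside `S`. -/
def LocalOn (S : Finset Q) (K : QOp Q) : Prop :=
  ∀ b c, K b c = if b \ S = c \ S then K (b ∩ S) (c ∩ S) else 0

theorem LocalOn.mono {S T : Finset Q} {K : QOp Q} (h : LocalOn S K) (hST : S ⊆ T) :
    LocalOn T K := by
  intro b c
  rw [h b c, h (b ∩ T) (c ∩ T)]
  have h1 : b ∩ T ∩ S = b ∩ S := by grind
  have h2 : c ∩ T ∩ S = c ∩ S := by grind
  have h3 : b \ S = c \ S ↔ b \ T = c \ T ∧ (b ∩ T) \ S = (c ∩ T) \ S := by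
    simp only [Finset.ext_iff, Finset.mem_sdiff, Finset.mem_inter]
    grind
  rw [h1, h2]
  grind

theorem localOn_one (S : Finset Q) : LocalOn S (1 : QOp Q) := by
  intro b c
  have h : b = c ↔ b \ S = c \ S ∧ b ∩ S = c ∩ S := by
    simp only [Finset.ext_iff, Finset.mem_sdiff, Finset.mem_inter]
    grind
  simp only [Matrix.one_apply]
  grind

theorem localOn_diagonal {S : Finset Q} {f : Finset Q → ℂ} (hf : ∀ b, f b = f (b ∩ S)) :
    LocalOn S (Matrix.diagonal f) := by
  intro b c
  have h : b = c ↔ b \ S = c \ S ∧ b ∩ S = c ∩ S := by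
    simp only [Finset.ext_iff, Finset.mem_sdiff, Finset.mem_inter]
    grind
  simp only [Matrix.diagonal_apply]
  have := hf b
  grind

theorem localOn_ctrlZ {i j : Q} {S : Finset Q} (hi : i ∈ S) (hj : j ∈ S) :
    LocalOn S (ctrlZ i j) :=
  localOn_diagonal fun b => by simp [hi, hj]

theorem localOn_pauliZ {i : Q} {S : Finset Q} (hi : i ∈ S) : LocalOn S (pauliZ i) :=
  localOn_diagonal fun b => by simp [hi]

theorem localOn_pauliX {i : Q} {S : Finset Q} (hi : i ∈ S) : LocalOn S (pauliX i) := by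
  intro b c
  have h : b = symmDiff c {i} ↔ b \ S = c \ S ∧ b ∩ S = symmDiff (c ∩ S) {i} := by
    simp only [Finset.ext_iff, Finset.mem_sdiff, Finset.mem_inter, Finset.mem_symmDiff,
      Finset.mem_singleton]
    grind
  simp only [pauliX, Matrix.of_apply]
  grind

theorem localOn_bra {i : Q} {S : Finset Q} (hi : i ∈ S) (β : ℝ) (v : Bool) :
    LocalOn S (bra i β v) := by
  intro b c
  have h : c = b ↔ b \ S = c \ S ∧ c ∩ S = b ∩ S := by
    simp only [Finset.ext_iff, Finset.mem_sdiff, Finset.mem_inter]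
    grind
  have h' : c = insert i b ↔ b \ S = c \ S ∧ c ∩ S = insert i (b ∩ S) := by
    simp only [Finset.ext_iff, Finset.mem_sdiff, Finset.mem_inter, Finset.mem_insert]
    grind
  have h'' : i ∈ b ↔ i ∈ b ∩ S := by simp [hi]
  simp only [bra, Matrix.of_apply, h, h', h'']
  by_cases hbc : b \ S = c \ S <;> simp [hbc]

theorem localOn_prep {S T : Finset Q} (hT : T ⊆ S) : LocalOn S (prep T) := by
  intro b c
  have h : b \ T = c ↔ b \ S = c \ S ∧ (b ∩ S) \ T = c ∩ S := by
    simp only [Finset.ext_iff, Finset.mem_sdiff, Finset.mem_inter]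
    grind
  simp only [prep, Matrix.of_apply]
  grind

/-- Summation over the basis of a register that consists of two disjoint ones. -/
theorem sum_powerset_union {M : Type*} [AddCommMonoid M] {S T : Finset Q} (h : Disjoint S T)
    (f : Finset Q → M) :
    ∑ d ∈ (S ∪ T).powerset, f d = ∑ d₁ ∈ S.powerset, ∑ d₂ ∈ T.powerset, f (d₁ ∪ d₂) := by
  rw [← Finset.sum_product']
  refine Finset.sum_nbij' (fun d => (d ∩ S, d ∩ T)) (fun p => p.1 ∪ p.2) ?_ ?_ ?_ ?_ ?_
  · intro d _
    simp
  · rintro ⟨d₁, d₂⟩ hd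
    simp only [Finset.mem_product, Finset.mem_powerset] at hd ⊢
    exact Finset.union_subset_union hd.1 hd.2
  · intro d hd
    simp only [Finset.mem_powerset] at hd
    grind
  · rintro ⟨d₁, d₂⟩ hd
    simp only [Finset.mem_product, Finset.mem_powerset] at hd
    rw [Finset.disjoint_left] at h
    ext x <;> simp only [Finset.mem_inter, Finset.mem_union] <;> grind
  · intro d hd
    simp only [Finset.mem_powerset] at hd
    congr 1
    grind

variable [Fintype Q]

/-- In a product with a local operator on the left only the qubits of that operator are summed
over. -/
theorem LocalOn.mul_apply {S : Finset Q} {K : QOp Q} (h : LocalOn S K) (M : QOp Q)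
    (b c : Finset Q) :
    (K * M) b c = ∑ d ∈ S.powerset, K (b ∩ S) d * M (d ∪ (b \ S)) c := by
  have hu : (Finset.univ : Finset (Finset Q)) = (S ∪ Sᶜ).powerset := by
    rw [Finset.union_compl]; ext; simp
  -- The index `d` is split as `d₁ ∪ d₂` with `d₁ ⊆ S`; only `d₂ = b \ S` contributes.
  rw [Matrix.mul_apply, hu, sum_powerset_union disjoint_compl_right]
  refine Finset.sum_congr rfl fun d₁ hd₁ => ?_
  rw [Finset.mem_powerset] at hd₁
  rw [Finset.sum_eq_single (b \ S)]
  · rw [h b, if_pos (by grind)]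
    congr 2
    grind
  · intro d₂ hd₂ hne
    rw [h b, if_neg, zero_mul]
    simp only [Finset.mem_powerset] at hd₂
    have : (d₁ ∪ d₂) \ S = d₂ := by
      ext x
      have := @hd₂ x
      simp only [Finset.mem_sdiff, Finset.mem_union, Finset.mem_compl] at *
      grind
    rw [this]
    exact fun e => hne e.symm
  · intro hn
    exact absurd (Finset.mem_powerset.2 (by intro x; simp)) hn

theorem LocalOn.mul {S : Finset Q} {K L : QOp Q} (hK : LocalOn S K) (hL : LocalOn S L) :
    LocalOn S (K * L) := by
  intro b c
  rw [hK.mul_apply, hK.mul_apply]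
  by_cases hbc : b \ S = c \ S
  · rw [if_pos hbc]
    refine Finset.sum_congr rfl fun d hd => ?_
    rw [Finset.mem_powerset] at hd
    rw [hL (d ∪ b \ S) c, if_pos (by grind)]
    congr 2 <;> grind
  · rw [if_neg hbc]
    refine Finset.sum_eq_zero fun d hd => ?_
    rw [Finset.mem_powerset] at hd
    rw [hL (d ∪ b \ S) c, if_neg (by grind), mul_zero]

theorem LocalOn.mul_apply_of_disjoint {S T : Finset Q} {K L : QOp Q} (hK : LocalOn S K)
    (hL : LocalOn T L) (h : Disjoint S T) (b c : Finset Q) :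
    (K * L) b c = if b \ (S ∪ T) = c \ (S ∪ T) then
      K (b ∩ S) (c ∩ S) * L (b ∩ T) (c ∩ T) else 0 := by
  rw [Finset.disjoint_left] at h
  rw [hK.mul_apply, Finset.sum_eq_single (c ∩ S)]
  · rw [hL (c ∩ S ∪ b \ S)]
    have h1 : (c ∩ S ∪ b \ S) \ T = c \ T ↔ b \ (S ∪ T) = c \ (S ∪ T) := by
      simp only [Finset.ext_iff, Finset.mem_sdiff, Finset.mem_inter, Finset.mem_union]
      grind
    have h2 : (c ∩ S ∪ b \ S) ∩ T = b ∩ T := by grind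
    rw [h2, mul_ite, mul_zero]
    simp only [h1]
  · intro d hd hne
    rw [Finset.mem_powerset] at hd
    rw [hL, if_neg, mul_zero]
    intro e
    refine hne (Finset.ext fun x => ?_)
    have := Finset.ext_iff.1 e x
    have := @hd x
    grind
  · intro hn
    exact absurd (Finset.mem_powerset.2 Finset.inter_subset_right) hn

/-- Operators on disjoint sets of qubits commute. -/
theorem LocalOn.commute {S T : Finset Q} {K L : QOp Q} (hK : LocalOn S K)
    (hL : LocalOn T L) (h : Disjoint S T) : K * L = L * K := by
  ext b c
  rw [hK.mul_apply_of_disjoint hL h, hL.mul_apply_of_disjoint hK h.symm,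
    Finset.union_comm, mul_comm]

end Operators

/-! ### Tensor products and completely positive maps -/

section Support

variable {Q : Type*}

/-- `K` maps states of the register `S` to states of the register `T`.  In contrast to
`IsOpFromTo`, nothing is required of `K` outside the register `S`. -/
def Carries (S T : Finset Q) (K : QOp Q) : Prop :=
  ∀ b c, c ⊆ S → K b c ≠ 0 → b ⊆ T

theorem IsOpFromTo.conjTranspose {S T : Finset Q} {K : QOp Q} (h : IsOpFromTo S T K) :
    IsOpFromTo T S Kᴴ := by
  intro b c hbc
  have := h c b (fun h0 => hbc (by rw [Matrix.conjTranspose_apply, h0, star_zero]))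
  exact this.symm

theorem IsOpFromTo.smul {S T : Finset Q} {K : QOp Q} (h : IsOpFromTo S T K) (z : ℂ) :
    IsOpFromTo S T (z • K) := by
  intro b c hbc
  refine h b c fun h0 => hbc ?_
  rw [Matrix.smul_apply, h0, smul_zero]

variable [Fintype Q]

theorem Carries.mul_isOpFromTo {R S T : Finset Q} {K M : QOp Q} (hK : Carries S T K)
    (hM : IsOpFromTo R S M) : IsOpFromTo R T (K * M) := by
  intro b c hbc
  rw [Matrix.mul_apply] at hbc
  obtain ⟨d, -, hd⟩ := Finset.exists_ne_zero_of_sum_ne_zero hbc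
  have h := hM d c (right_ne_zero_of_mul hd)
  exact ⟨hK b d h.1 (left_ne_zero_of_mul hd), h.2⟩

theorem Carries.conj_isOpFromTo {S T : Finset Q} {K M : QOp Q} (hK : Carries S T K)
    (hM : IsOpFromTo S S M) : IsOpFromTo T T (K * M * Kᴴ) := by
  have h := hK.mul_isOpFromTo (hK.mul_isOpFromTo hM).conjTranspose
  simpa [Matrix.mul_assoc] using h.conjTranspose

theorem Carries.mul {R S T : Finset Q} {K L : QOp Q} (hK : Carries S T K)
    (hL : Carries R S L) : Carries R T (K * L) := by
  intro b c hc hbc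
  rw [Matrix.mul_apply] at hbc
  obtain ⟨d, -, hd⟩ := Finset.exists_ne_zero_of_sum_ne_zero hbc
  exact hK b d (hL d c hc (right_ne_zero_of_mul hd)) (left_ne_zero_of_mul hd)

end Support

section Tensor

variable {Q : Type*} [DecidableEq Q]

/-- The tensor product of an operator from `U` to `S` and an operator from `V` to `T`. -/
def rectTensor (S T U V : Finset Q) (ρ σ : QOp Q) : QOp Q :=
  Matrix.of fun b c =>
    if b ⊆ S ∪ T ∧ c ⊆ U ∪ V then ρ (b ∩ S) (c ∩ U) * σ (b ∩ T) (c ∩ V) else 0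

theorem tensor_eq_rectTensor (S T : Finset Q) (ρ σ : QOp Q) :
    tensor S T ρ σ = rectTensor S T S T ρ σ := rfl

theorem rectTensor_conjTranspose (S T U V : Finset Q) (ρ σ : QOp Q) :
    (rectTensor S T U V ρ σ)ᴴ = rectTensor U V S T ρᴴ σᴴ := by
  ext b c
  simp only [rectTensor, Matrix.conjTranspose_apply, Matrix.of_apply]
  rw [apply_ite (star : ℂ → ℂ), star_mul', star_zero]
  simp only [and_comm]

theorem rectTensor_comm (S T U V : Finset Q) (ρ σ : QOp Q) :
    rectTensor S T U V ρ σ = rectTensor T S V U σ ρ := by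
  ext b c
  simp only [rectTensor, Matrix.of_apply, Finset.union_comm S T, Finset.union_comm U V, mul_comm]

theorem tensor_comm (S T : Finset Q) (ρ σ : QOp Q) : tensor S T ρ σ = tensor T S σ ρ :=
  rectTensor_comm S T S T ρ σ

theorem isOpFromTo_tensor (S T : Finset Q) (ρ σ : QOp Q) :
    IsOpFromTo (S ∪ T) (S ∪ T) (tensor S T ρ σ) := by
  intro b c h
  by_contra hn
  exact h (by simp only [tensor, Matrix.of_apply, if_neg hn])

theorem tensor_smul_right (S T : Finset Q) (z : ℂ) (ρ σ : QOp Q) :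
    tensor S T ρ (z • σ) = z • tensor S T ρ σ := by
  rw [tensor_comm, tensor_smul_left, tensor_comm S T ρ σ]

theorem tensor_zero_left (S T : Finset Q) (σ : QOp Q) : tensor S T 0 σ = 0 := by
  simpa using tensor_smul_left S T 0 0 σ

theorem tensor_sum_left {ι : Type*} (s : Finset ι) (S T : Finset Q) (f : ι → QOp Q) (σ : QOp Q) :
    tensor S T (∑ i ∈ s, f i) σ = ∑ i ∈ s, tensor S T (f i) σ := by
  classical
  induction s using Finset.induction_on with
  | empty => simp [tensor_zero_left]
  | insert i s hi ih => rw [Finset.sum_insert hi, Finset.sum_insert hi, tensor_add_left, ih]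

theorem tensor_sum_right {ι : Type*} (s : Finset ι) (S T : Finset Q) (ρ : QOp Q)
    (f : ι → QOp Q) : tensor S T ρ (∑ i ∈ s, f i) = ∑ i ∈ s, tensor S T ρ (f i) := by
  simp only [tensor_comm S T ρ, tensor_sum_left]

/-- No disjointness is needed, since `b ∩ (S ∪ T) ∩ S = b ∩ S` in any case. -/
theorem tensor_assoc (S T U : Finset Q) (ρ σ τ : QOp Q) :
    tensor S (T ∪ U) ρ (tensor T U σ τ) = tensor (S ∪ T) U (tensor S T ρ σ) τ := by
  ext b c
  have el : ∀ b S T : Finset Q, b ∩ (S ∪ T) ∩ S = b ∩ S := by grind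
  have er : ∀ b S T : Finset Q, b ∩ (S ∪ T) ∩ T = b ∩ T := by grind
  simp only [tensor, Matrix.of_apply, el, er, Finset.inter_subset_right, and_self, if_true,
    Finset.union_assoc, mul_assoc]

/-- Two pairs of registers are regrouped. -/
theorem tensor_tensor_tensor_comm (S T U V : Finset Q) (ρ σ τ ω : QOp Q) :
    tensor (S ∪ T) (U ∪ V) (tensor S T ρ σ) (tensor U V τ ω) =
      tensor (S ∪ U) (T ∪ V) (tensor S U ρ τ) (tensor T V σ ω) := by
  ext b c
  have el : ∀ b S T : Finset Q, b ∩ (S ∪ T) ∩ S = b ∩ S := by grind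
  have er : ∀ b S T : Finset Q, b ∩ (S ∪ T) ∩ T = b ∩ T := by grind
  have e : S ∪ T ∪ (U ∪ V) = S ∪ U ∪ (T ∪ V) := by grind
  simp only [tensor, Matrix.of_apply, el, er, e,
    Finset.inter_subset_right, and_self, if_true]
  split_ifs <;> ring

/-- The Kraus operators `id ⊗ |v⟩` of the map that adjoins to the register `S` the register `T` in
the state `BᴴB`; the vectors `v` are the conjugated rows of `B`. -/
def adjoin (S T : Finset Q) (B : QOp Q) (j : Finset Q) : QOp Q :=
  Matrix.of fun b c => if b ⊆ S ∪ T ∧ b ∩ S = c then star (B j (b ∩ T)) else 0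

theorem isOpFromTo_adjoin (S T : Finset Q) (B : QOp Q) (j : Finset Q) :
    IsOpFromTo S (S ∪ T) (adjoin S T B j) := by
  intro b c h
  simp only [adjoin, Matrix.of_apply] at h
  split_ifs at h with hb
  · exact ⟨hb.1, hb.2 ▸ Finset.inter_subset_right⟩
  · exact absurd rfl h

variable [Fintype Q]

/-- The row index of a product is acted upon by a local operator; the column index is arbitrary, so
that the same statement, applied to adjoints, covers the multiplication from the right. -/
theorem LocalOn.mul_rectTensor {N S S' T U V : Finset Q} {K : QOp Q} (hK : LocalOn N K)
    (hNT : Disjoint N T) (hS : S ⊆ N) (hS' : S' ⊆ N) (hc : Carries S S' K) {ρ : QOp Q}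
    (hρ : ∀ b c, ρ b c ≠ 0 → b ⊆ S) (σ : QOp Q) :
    K * rectTensor S T U V ρ σ = rectTensor S' T U V (K * ρ) σ := by
  rw [Finset.disjoint_left] at hNT
  ext b c
  rw [hK.mul_apply]
  simp only [rectTensor, Matrix.of_apply]
  by_cases hcU : c ⊆ U ∪ V
  swap
  · simp [hcU]
  by_cases hbT : b \ N ⊆ T
  swap
  · obtain ⟨x, hx, hxT⟩ := Finset.not_subset.1 hbT
    rw [if_neg fun h => by have := @h.1 x; grind, Finset.sum_eq_zero]
    intro d hd
    rw [if_neg fun h => by have := @h.1 x; grind, mul_zero]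
  have hsum : ∀ d ∈ N.powerset, K (b ∩ N) d * (if d ∪ b \ N ⊆ S ∪ T ∧ c ⊆ U ∪ V then
      ρ ((d ∪ b \ N) ∩ S) (c ∩ U) * σ ((d ∪ b \ N) ∩ T) (c ∩ V) else 0) =
      K (b ∩ N) d * ρ d (c ∩ U) * σ (b ∩ T) (c ∩ V) := by
    intro d hd
    rw [Finset.mem_powerset] at hd
    by_cases hdS : d ⊆ S
    · have h1 : (d ∪ b \ N) ∩ S = d := by grind
      have h2 : (d ∪ b \ N) ∩ T = b ∩ T := by grind
      rw [if_pos ⟨by grind, hcU⟩, h1, h2, mul_assoc]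
    · obtain ⟨x, hx, hxS⟩ := Finset.not_subset.1 hdS
      rw [if_neg fun h => by have := @h.1 x; grind]
      have : ρ d (c ∩ U) = 0 := by
        by_contra h
        exact hdS (hρ _ _ h)
      simp [this]
  rw [Finset.sum_congr rfl hsum, ← Finset.sum_mul]
  have hall : ∑ d ∈ N.powerset, K (b ∩ N) d * ρ d (c ∩ U) = (K * ρ) (b ∩ N) (c ∩ U) := by
    rw [Matrix.mul_apply]
    refine Finset.sum_subset (Finset.subset_univ _) fun d _ hd => ?_
    have : ρ d (c ∩ U) = 0 := by
      by_contra h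
      exact hd (Finset.mem_powerset.2 ((hρ _ _ h).trans hS))
    simp [this]
  rw [hall]
  by_cases hb : b ⊆ S' ∪ T
  · have h1 : b ∩ N = b ∩ S' := by grind
    rw [if_pos ⟨hb, hcU⟩, h1]
  · rw [if_neg (by simp [hb])]
    have : (K * ρ) (b ∩ N) (c ∩ U) = 0 := by
      by_contra h
      rw [Matrix.mul_apply] at h
      obtain ⟨d, -, hd⟩ := Finset.exists_ne_zero_of_sum_ne_zero h
      have := hc _ d (hρ _ _ (right_ne_zero_of_mul hd)) (left_ne_zero_of_mul hd)
      grind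
    rw [this, zero_mul]

/-- A local operator acts on the factor of a product state that contains its qubits. -/
theorem LocalOn.conj_tensor_left {N S S' T : Finset Q} {K : QOp Q} (hK : LocalOn N K)
    (hNT : Disjoint N T) (hS : S ⊆ N) (hS' : S' ⊆ N) (hc : Carries S S' K) {ρ : QOp Q}
    (hρ : IsOpFromTo S S ρ) (σ : QOp Q) :
    K * tensor S T ρ σ * Kᴴ = tensor S' T (K * ρ * Kᴴ) σ := by
  have h1 := hK.mul_rectTensor (U := S) (V := T) hNT hS hS' hc (fun b c h => (hρ b c h).1) σ
  have h2 := hK.mul_rectTensor (U := S') (V := T) (ρ := (K * ρ)ᴴ) hNT hS hS' hc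
    (fun b c h => ((hc.mul_isOpFromTo hρ).conjTranspose b c h).1) σᴴ
  rw [tensor_eq_rectTensor, h1, tensor_eq_rectTensor]
  have h3 := congrArg Matrix.conjTranspose h2
  simp only [Matrix.conjTranspose_mul, rectTensor_conjTranspose,
    Matrix.conjTranspose_conjTranspose] at h3
  exact h3

/-- Operators on disjoint sets of qubits act on the two factors of a product state. -/
theorem conj_tensor {N₁ N₂ S S' T T' : Finset Q} {K L : QOp Q} (hK : LocalOn N₁ K)
    (hL : LocalOn N₂ L) (h : Disjoint N₁ N₂) (hS : S ⊆ N₁) (hS' : S' ⊆ N₁) (hT : T ⊆ N₂)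
    (hT' : T' ⊆ N₂) (hcK : Carries S S' K) (hcL : Carries T T' L) {ρ σ : QOp Q}
    (hρ : IsOpFromTo S S ρ) (hσ : IsOpFromTo T T σ) :
    (L * K) * tensor S T ρ σ * (L * K)ᴴ = tensor S' T' (K * ρ * Kᴴ) (L * σ * Lᴴ) := by
  have h1 := hK.conj_tensor_left (h.mono_right hT) hS hS' hcK hρ σ
  have h2 := hL.conj_tensor_left (h.symm.mono_right hS') hT hT' hcL hσ (K * ρ * Kᴴ)
  rw [tensor_comm S' T', ← h2, tensor_comm T S', ← h1, Matrix.conjTranspose_mul]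
  simp only [Matrix.mul_assoc]

theorem trace_tensor {S T : Finset Q} (h : Disjoint S T) {ρ σ : QOp Q}
    (hρ : IsOpFromTo S S ρ) (hσ : IsOpFromTo T T σ) :
    (tensor S T ρ σ).trace = ρ.trace * σ.trace := by
  have hsupp : ∀ {R : Finset Q} {M : QOp Q}, IsOpFromTo R R M →
      M.trace = ∑ d ∈ R.powerset, M d d := by
    intro R M hM
    refine (Finset.sum_subset (Finset.subset_univ _) fun d _ hd => ?_).symm
    by_contra h0
    exact hd (Finset.mem_powerset.2 (hM d d h0).1)
  rw [hsupp (isOpFromTo_tensor S T ρ σ), hsupp hρ, hsupp hσ, sum_powerset_union h,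
    Finset.sum_mul_sum]
  rw [Finset.disjoint_left] at h
  refine Finset.sum_congr rfl fun d₁ h₁ => Finset.sum_congr rfl fun d₂ h₂ => ?_
  rw [Finset.mem_powerset] at h₁ h₂
  have e1 : (d₁ ∪ d₂) ∩ S = d₁ := by grind
  have e2 : (d₁ ∪ d₂) ∩ T = d₂ := by grind
  have e3 := Finset.union_subset_union h₁ h₂
  simp only [tensor, Matrix.of_apply, e1, e2, e3, and_self, if_true]

theorem tensor_eq_sum_adjoin (S T : Finset Q) (ρ B : QOp Q) :
    tensor S T ρ (Bᴴ * B) = ∑ j, adjoin S T B j * ρ * (adjoin S T B j)ᴴ := by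
  have hmul : ∀ (j : Finset Q) (M : QOp Q) (b c : Finset Q), (adjoin S T B j * M) b c =
      if b ⊆ S ∪ T then star (B j (b ∩ T)) * M (b ∩ S) c else 0 := by
    intro j M b c
    rw [Matrix.mul_apply, Finset.sum_eq_single (b ∩ S)]
    · simp [adjoin]
    · intro d _ hd
      simp [adjoin, hd.symm]
    · simp
  have hmul' : ∀ (j : Finset Q) (M : QOp Q) (b c : Finset Q), (M * (adjoin S T B j)ᴴ) b c =
      if c ⊆ S ∪ T then M b (c ∩ S) * B j (c ∩ T) else 0 := by
    intro j M b c
    have := congrArg star (hmul j Mᴴ c b)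
    rw [← Matrix.conjTranspose_apply, Matrix.conjTranspose_mul,
      Matrix.conjTranspose_conjTranspose] at this
    rw [this]
    split_ifs <;> simp [mul_comm]
  ext b c
  rw [Matrix.sum_apply]
  simp only [hmul', hmul, tensor, Matrix.of_apply]
  by_cases hb : b ⊆ S ∪ T <;> by_cases hc : c ⊆ S ∪ T <;> simp only [hb, hc, and_self, and_true,
    and_false, if_true, if_false, zero_mul, Finset.sum_const_zero]
  rw [Matrix.mul_apply, Finset.mul_sum]
  refine Finset.sum_congr rfl fun j _ => ?_
  rw [Matrix.conjTranspose_apply]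
  ring

open scoped MatrixOrder in
theorem exists_eq_conjTranspose_mul_self {σ : QOp Q} (hσ : σ.PosSemidef) :
    ∃ B : QOp Q, σ = Bᴴ * B :=
  CStarAlgebra.nonneg_iff_eq_star_mul_self.1 hσ.nonneg

/-- The sets `S` and `T` may overlap: the Kraus decomposition of `tensor_eq_sum_adjoin` holds in any
case. -/
theorem posSemidef_tensor {S T : Finset Q} {ρ σ : QOp Q} (hρ : ρ.PosSemidef)
    (hσ : σ.PosSemidef) : (tensor S T ρ σ).PosSemidef := by
  obtain ⟨B, rfl⟩ := exists_eq_conjTranspose_mul_self hσ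
  rw [tensor_eq_sum_adjoin]
  exact Matrix.posSemidef_sum _ fun j _ => hρ.mul_mul_conjTranspose_same _

theorem IsDensity.tensor {S T : Finset Q} (h : Disjoint S T) {ρ σ : QOp Q}
    (hρ : IsDensity S ρ) (hσ : IsDensity T σ) : IsDensity (S ∪ T) (tensor S T ρ σ) :=
  ⟨posSemidef_tensor hρ.1 hσ.1, by rw [trace_tensor h hρ.2.2 hσ.2.2, hρ.2.1, hσ.2.1, one_mul],
    isOpFromTo_tensor S T ρ σ⟩

/-- A map of the form `ρ ↦ ∑ k, K k (ρ ⊗ σ) (K k)†` is completely positive. -/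
theorem isCPM_of_kraus {ι : Type*} (s : Finset ι) {S T U : Finset Q} {σ : QOp Q}
    (hσ : σ.PosSemidef) {K : ι → QOp Q} (hK : ∀ k ∈ s, Carries (S ∪ T) U (K k))
    {L : QOp Q →ₗ[ℂ] QOp Q} (hL : ∀ ρ, L ρ = ∑ k ∈ s, K k * tensor S T ρ σ * (K k)ᴴ) :
    IsCPM S U L := by
  obtain ⟨B, rfl⟩ := exists_eq_conjTranspose_mul_self hσ
  let e := Fintype.equivFin (s × Finset Q)
  refine ⟨Fintype.card (s × Finset Q),
    fun n => K (e.symm n).1 * adjoin S T B (e.symm n).2, fun n => ?_, fun ρ => ?_⟩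
  · exact (hK _ (e.symm n).1.2).mul_isOpFromTo (isOpFromTo_adjoin S T B _)
  · rw [hL, Equiv.sum_comp e.symm (fun p : s × Finset Q =>
      K p.1 * adjoin S T B p.2 * ρ * (K p.1 * adjoin S T B p.2)ᴴ), Fintype.sum_prod_type,
      ← Finset.sum_coe_sort s]
    refine Finset.sum_congr rfl fun k _ => ?_
    rw [tensor_eq_sum_adjoin, Finset.mul_sum, Finset.sum_mul]
    refine Finset.sum_congr rfl fun j _ => ?_
    rw [Matrix.conjTranspose_mul]
    simp only [Matrix.mul_assoc]

end Tensor

/-! ### Execution of patterns -/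

section Execution

variable {Q X : Type*}

/-- The memory `Δ` extends the memory `Γ`. -/
def MemLe (Γ Δ : Mem Q X) : Prop := ∀ r v, Γ r = some v → Δ r = some v

theorem MemLe.refl (Γ : Mem Q X) : MemLe Γ Γ := fun _ _ h => h

theorem MemLe.eval {Γ Δ : Mem Q X} (h : MemLe Γ Δ) {s : Signal Q X} {v : Bool}
    (hs : s.eval Γ = some v) : s.eval Δ = some v := by
  induction s generalizing v with
  | zero => exact hs
  | one => exact hs
  | ref r => exact h r v hs
  | add s t ihs iht =>
    simp only [Signal.eval, Option.bind_eq_some_iff, Option.map_eq_some_iff] at hs ⊢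
    obtain ⟨a, ha, b, hb, rfl⟩ := hs
    exact ⟨a, ihs ha, b, iht hb, rfl⟩

variable [DecidableEq Q] [DecidableEq X]

theorem MemLe.update {Γ Δ : Mem Q X} (h : MemLe Γ Δ) (x : Ref Q X) (v : Option Bool) :
    MemLe (Function.update Γ x v) (Function.update Δ x v) := by
  intro r u
  by_cases hr : r = x
  · subst hr
    simp
  · simpa [Function.update_of_ne hr] using h r u

theorem carries_of_diagonal (S : Finset Q) (f : Finset Q → ℂ) :
    Carries S S (Matrix.diagonal f) := by
  intro b c hc h
  by_cases hbc : b = c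
  · exact hbc ▸ hc
  · exact absurd (Matrix.diagonal_apply_ne f hbc) h

theorem carries_one (S : Finset Q) : Carries S S (1 : QOp Q) := by
  rw [← Matrix.diagonal_one]
  exact carries_of_diagonal S _

theorem carries_pauliX {i : Q} {S : Finset Q} (hi : i ∈ S) : Carries S S (pauliX i) := by
  intro b c hc h
  simp only [pauliX, Matrix.of_apply] at h
  split_ifs at h with hb
  · intro x hx
    rw [hb, Finset.mem_symmDiff, Finset.mem_singleton] at hx
    rcases hx with hx | hx
    · exact hc hx.1
    · exact hx.1 ▸ hi
  · exact absurd rfl h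

theorem carries_bra (i : Q) (S : Finset Q) (β : ℝ) (v : Bool) :
    Carries S (S.erase i) (bra i β v) := by
  intro b c hc h
  simp only [bra, Matrix.of_apply] at h
  split_ifs at h with h1 h2 h3
  all_goals first
    | exact absurd rfl h
    | exact Finset.subset_erase.2 ⟨by subst_vars; first | exact hc |
        exact (Finset.subset_insert _ _).trans hc, h1⟩

theorem carries_prep (S T : Finset Q) : Carries S (S ∪ T) (prep T) := by
  intro b c hc h
  simp only [prep, Matrix.of_apply] at h
  split_ifs at h with hb
  · subst hb
    exact fun x hx => by have := @hc x; simp at this ⊢; tauto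
  · exact absurd rfl h

/-- A command with present qubits `W` acts on `W` only, and it leads to states of the qubits `W'`
that are left.  The three properties together are stable under composition, see `execCmds_spec`. -/
theorem Cmd.exec_spec {o W W' : Finset Q} {Γ Γ' : Mem Q X} {C : Cmd Q X} {L : QOp Q}
    (h : C.exec o W Γ = some (L, W', Γ')) : W' ⊆ W ∧ LocalOn W L ∧ Carries W W' L := by
  cases C with
  | E i j =>
    simp only [Cmd.exec] at h
    split_ifs at h with hi
    simp only [Option.some.injEq, Prod.mk.injEq] at h
    obtain ⟨rfl, rfl, rfl⟩ := h
    exact ⟨subset_rfl, localOn_ctrlZ hi.1 hi.2.1, carries_of_diagonal _ _⟩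
  | X i s =>
    simp only [Cmd.exec] at h
    split_ifs at h with hi
    simp only [Option.map_eq_some_iff, Prod.mk.injEq] at h
    obtain ⟨v, -, rfl, rfl, rfl⟩ := h
    cases v
    · exact ⟨subset_rfl, localOn_one _, carries_one _⟩
    · exact ⟨subset_rfl, localOn_pauliX hi, carries_pauliX hi⟩
  | Z i s =>
    simp only [Cmd.exec] at h
    split_ifs at h with hi
    simp only [Option.map_eq_some_iff, Prod.mk.injEq] at h
    obtain ⟨v, -, rfl, rfl, rfl⟩ := h
    cases v
    · exact ⟨subset_rfl, localOn_one _, carries_one _⟩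
    · exact ⟨subset_rfl, localOn_pauliZ hi, carries_of_diagonal _ _⟩
  | M α i s t =>
    simp only [Cmd.exec] at h
    split_ifs at h with hi
    all_goals
      simp only [Option.bind_eq_some_iff, Option.map_eq_some_iff, Prod.mk.injEq] at h
      obtain ⟨v, -, u, -, rfl, rfl, rfl⟩ := h
      exact ⟨Finset.erase_subset _ _, localOn_bra hi _ _, carries_bra _ _ _ _⟩

/-- The measured qubits are those of `W \ W'`. -/
theorem Cmd.exec_congr {o o' W W' : Finset Q} {Γ Γ' : Mem Q X} {C : Cmd Q X} {L : QOp Q}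
    (h : C.exec o W Γ = some (L, W', Γ')) (ho : ∀ i ∈ W \ W', i ∈ o ↔ i ∈ o') :
    C.exec o' W Γ = some (L, W', Γ') := by
  cases C with
  | E i j => exact h
  | X i s => exact h
  | Z i s => exact h
  | M α i s t =>
    simp only [Cmd.exec] at h ⊢
    by_cases hi : i ∈ W
    · have hW : W' = W.erase i := by
        simp only [hi, if_true, Option.bind_eq_some_iff, Option.map_eq_some_iff,
          Prod.mk.injEq] at h
        obtain ⟨v, -, u, -, -, h, -⟩ := h
        exact h.symm
      have : i ∈ o ↔ i ∈ o' := ho i (by simp [hW, hi])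
      simpa only [this] using h
    · simp [hi] at h

theorem Cmd.exec_mono {o W W' : Finset Q} {Γ Γ' Δ : Mem Q X} {C : Cmd Q X} {L : QOp Q}
    (h : C.exec o W Γ = some (L, W', Γ')) (hΓ : MemLe Γ Δ) :
    ∃ Δ', C.exec o W Δ = some (L, W', Δ') ∧ MemLe Γ' Δ' := by
  cases C with
  | E i j =>
    simp only [Cmd.exec] at h ⊢
    split_ifs at h ⊢ with hi
    simp only [Option.some.injEq, Prod.mk.injEq] at h
    obtain ⟨rfl, rfl, rfl⟩ := h
    exact ⟨Δ, rfl, hΓ⟩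
  | X i s =>
    simp only [Cmd.exec] at h ⊢
    split_ifs at h ⊢ with hi
    simp only [Option.map_eq_some_iff, Prod.mk.injEq] at h
    obtain ⟨v, hv, rfl, rfl, rfl⟩ := h
    exact ⟨Δ, by rw [hΓ.eval hv]; rfl, hΓ⟩
  | Z i s =>
    simp only [Cmd.exec] at h ⊢
    split_ifs at h ⊢ with hi
    simp only [Option.map_eq_some_iff, Prod.mk.injEq] at h
    obtain ⟨v, hv, rfl, rfl, rfl⟩ := h
    exact ⟨Δ, by rw [hΓ.eval hv]; rfl, hΓ⟩
  | M α i s t =>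
    simp only [Cmd.exec] at h ⊢
    by_cases hi : i ∈ W
    · simp only [hi, if_true, Option.bind_eq_some_iff, Option.map_eq_some_iff,
        Prod.mk.injEq] at h ⊢
      obtain ⟨v, hv, u, hu, rfl, rfl, rfl⟩ := h
      exact ⟨_, ⟨v, hΓ.eval hv, u, hΓ.eval hu, rfl, rfl, rfl⟩, hΓ.update _ _⟩
    · simp [hi] at h

variable [Fintype Q]

theorem execCmds_cons_eq_some {o W W' : Finset Q} {Γ Γ' : Mem Q X} {C : Cmd Q X}
    {cs : List (Cmd Q X)} {L : QOp Q} :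
    execCmds o (C :: cs) W Γ = some (L, W', Γ') ↔ ∃ L₁ W₁ Γ₁ L₂,
      C.exec o W Γ = some (L₁, W₁, Γ₁) ∧ execCmds o cs W₁ Γ₁ = some (L₂, W', Γ') ∧
        L = L₂ * L₁ := by
  simp only [execCmds, Option.bind_eq_some_iff, Option.map_eq_some_iff, Prod.exists,
    Prod.mk.injEq]
  constructor
  · rintro ⟨L₁, W₁, Γ₁, h₁, L₂, W₂, Γ₂, h₂, h, rfl, rfl⟩
    exact ⟨L₁, W₁, Γ₁, L₂, h₁, h₂, h.symm⟩
  · rintro ⟨L₁, W₁, Γ₁, L₂, h₁, h₂, rfl⟩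
    exact ⟨L₁, W₁, Γ₁, h₁, L₂, W', Γ', h₂, rfl, rfl, rfl⟩

theorem execCmds_spec {o W W' : Finset Q} {Γ Γ' : Mem Q X} {cs : List (Cmd Q X)} {L : QOp Q}
    (h : execCmds o cs W Γ = some (L, W', Γ')) : W' ⊆ W ∧ LocalOn W L ∧ Carries W W' L := by
  induction cs generalizing W Γ L with
  | nil =>
    simp only [execCmds, Option.some.injEq, Prod.mk.injEq] at h
    obtain ⟨rfl, rfl, rfl⟩ := h
    exact ⟨subset_rfl, localOn_one _, carries_one _⟩
  | cons C cs ih =>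
    obtain ⟨L₁, W₁, Γ₁, L₂, h₁, h₂, rfl⟩ := execCmds_cons_eq_some.1 h
    obtain ⟨s₁, l₁, c₁⟩ := Cmd.exec_spec h₁
    obtain ⟨s₂, l₂, c₂⟩ := ih h₂
    exact ⟨s₂.trans s₁, (l₂.mono s₁).mul l₁, c₂.mul c₁⟩

theorem execCmds_congr {o o' W W' : Finset Q} {Γ Γ' : Mem Q X} {cs : List (Cmd Q X)}
    {L : QOp Q} (h : execCmds o cs W Γ = some (L, W', Γ'))
    (ho : ∀ i ∈ W \ W', i ∈ o ↔ i ∈ o') : execCmds o' cs W Γ = some (L, W', Γ') := by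
  induction cs generalizing W Γ L with
  | nil => exact h
  | cons C cs ih =>
    obtain ⟨L₁, W₁, Γ₁, L₂, h₁, h₂, rfl⟩ := execCmds_cons_eq_some.1 h
    have s₁ := (Cmd.exec_spec h₁).1
    have s₂ := (execCmds_spec h₂).1
    exact execCmds_cons_eq_some.2 ⟨L₁, W₁, Γ₁, L₂,
      Cmd.exec_congr h₁ fun i hi => ho i (Finset.sdiff_subset_sdiff subset_rfl s₂ hi),
      ih h₂ fun i hi => ho i (Finset.sdiff_subset_sdiff s₁ subset_rfl hi), rfl⟩

theorem execCmds_mono {o W W' : Finset Q} {Γ Γ' Δ : Mem Q X} {cs : List (Cmd Q X)} {L : QOp Q}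
    (h : execCmds o cs W Γ = some (L, W', Γ')) (hΓ : MemLe Γ Δ) :
    ∃ Δ', execCmds o cs W Δ = some (L, W', Δ') ∧ MemLe Γ' Δ' := by
  induction cs generalizing W Γ Δ L with
  | nil =>
    simp only [execCmds, Option.some.injEq, Prod.mk.injEq] at h
    obtain ⟨rfl, rfl, rfl⟩ := h
    exact ⟨Δ, rfl, hΓ⟩
  | cons C cs ih =>
    obtain ⟨L₁, W₁, Γ₁, L₂, h₁, h₂, rfl⟩ := execCmds_cons_eq_some.1 h
    obtain ⟨Δ₁, h₁', hΔ₁⟩ := Cmd.exec_mono h₁ hΓ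
    obtain ⟨Δ₂, h₂', hΔ₂⟩ := ih h₂ hΔ₁
    exact ⟨Δ₂, execCmds_cons_eq_some.2 ⟨_, _, _, _, h₁', h₂', rfl⟩, hΔ₂⟩

theorem Pattern.exec_eq_some {o : Finset Q} {Γ Γ' : Mem Q X} {P : Pattern Q X} {L : QOp Q} :
    P.exec o Γ = some (L, Γ') ↔ P.I ⊆ P.V ∧ ∃ L₁,
      execCmds o P.cmds P.V Γ = some (L₁, P.O, Γ') ∧ L = L₁ * prep (P.V \ P.I) := by
  unfold Pattern.exec
  split_ifs with hI
  · simp only [Option.bind_eq_some_iff, Prod.exists, Option.ite_none_right_eq_some,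
      Option.some.injEq, Prod.mk.injEq, hI, true_and]
    constructor
    · rintro ⟨L₁, W, Γ₁, h, rfl, rfl, rfl⟩
      exact ⟨L₁, h, rfl⟩
    · rintro ⟨L₁, h, rfl⟩
      exact ⟨L₁, _, _, h, rfl, rfl, rfl⟩
  · simp [hI]

theorem Pattern.exec_spec {o : Finset Q} {Γ Γ' : Mem Q X} {P : Pattern Q X} {L : QOp Q}
    (h : P.exec o Γ = some (L, Γ')) :
    P.I ⊆ P.V ∧ P.O ⊆ P.V ∧ LocalOn P.V L ∧ Carries P.I P.O L := by
  obtain ⟨hI, L₁, h₁, rfl⟩ := Pattern.exec_eq_some.1 h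
  obtain ⟨hO, hl, hc⟩ := execCmds_spec h₁
  refine ⟨hI, hO, hl.mul (localOn_prep Finset.sdiff_subset), hc.mul ?_⟩
  have := carries_prep P.I (P.V \ P.I)
  rwa [Finset.union_sdiff_of_subset hI] at this

/-- The execution of a pattern depends only on the outcomes of its own measurements. -/
theorem Pattern.exec_congr {o o' : Finset Q} {Γ Γ' : Mem Q X} {P : Pattern Q X} {L : QOp Q}
    (h : P.exec o Γ = some (L, Γ')) (ho : ∀ i ∈ P.V \ P.O, i ∈ o ↔ i ∈ o') :
    P.exec o' Γ = some (L, Γ') := by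
  obtain ⟨hI, L₁, h₁, rfl⟩ := Pattern.exec_eq_some.1 h
  exact Pattern.exec_eq_some.2 ⟨hI, L₁, execCmds_congr h₁ ho, rfl⟩

/-- A pattern that runs in a memory runs in the same way in any larger memory. -/
theorem Pattern.exec_mono {o : Finset Q} {Γ Γ' Δ : Mem Q X} {P : Pattern Q X} {L : QOp Q}
    (h : P.exec o Γ = some (L, Γ')) (hΓ : MemLe Γ Δ) :
    ∃ Δ', P.exec o Δ = some (L, Δ') ∧ MemLe Γ' Δ' := by
  obtain ⟨hI, L₁, h₁, rfl⟩ := Pattern.exec_eq_some.1 h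
  obtain ⟨Δ', h', hΔ⟩ := execCmds_mono h₁ hΓ
  exact ⟨Δ', Pattern.exec_eq_some.2 ⟨hI, L₁, h', rfl⟩, hΔ⟩

end Execution

/-! ### Invariants of the small steps -/

section Gather

variable {Q X Ch : Type*} [DecidableEq Q]

theorem mem_gather {f : Event Q X Ch → Finset Q} {es : List (Event Q X Ch)} {x : Q} :
    x ∈ gather f es ↔ ∃ e ∈ es, x ∈ f e := by
  induction es with
  | nil => simp [gather]
  | cons e es ih =>
    have : gather f (e :: es) = f e ∪ gather f es := rfl
    simp [this, ih]

theorem gather_append (f : Event Q X Ch → Finset Q) (es fs : List (Event Q X Ch)) :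
    gather f (es ++ fs) = gather f es ∪ gather f fs := by
  ext x
  simp only [mem_gather, Finset.mem_union, List.mem_append, or_and_right, exists_or]

theorem gather_prepared_subset_space {es : List (Event Q X Ch)} :
    gather Event.prepared es ⊆ gather Event.space es := by
  intro x hx
  obtain ⟨e, he, hx⟩ := mem_gather.1 hx
  refine mem_gather.2 ⟨e, he, ?_⟩
  cases e <;> simp_all [Event.prepared, Event.space]

theorem gather_measured_subset_space {es : List (Event Q X Ch)} :
    gather Event.measured es ⊆ gather Event.space es := by
  intro x hx
  obtain ⟨e, he, hx⟩ := mem_gather.1 hx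
  refine mem_gather.2 ⟨e, he, ?_⟩
  cases e <;> simp_all [Event.measured, Event.space]

end Gather

section Confluence

variable {A Q X Ch : Type*} [DecidableEq Q]

/-- The static part of the definiteness conditions, for the configurations of a computation: the
qubits owned by different agents and the qubits that are still to be prepared are different, and
each channel joins at most two agents.  It is an invariant of the computation. -/
structure Sound (c : A → AgentState Q X Ch) : Prop where
  own : ∀ a b x, x ∈ (c a).own → x ∈ (c b).own → a = b
  fresh : ∀ a b x, x ∈ gather Event.prepared (c a).prog → x ∉ (c b).own
  agents : ∀ a b x, x ∈ gather Event.prepared (c a).prog →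
    x ∈ gather Event.prepared (c b).prog → a = b
  once : ∀ a, (c a).prog.Pairwise fun e f => Disjoint e.prepared f.prepared
  chan : ∀ ch, {a | ∃ e ∈ (c a).prog, e.chan? = some ch}.ncard ≤ 2

/-- A channel has only one other end.  The number of agents has to be finite here, as the
cardinality `ncard` of an infinite set is `0`. -/
theorem Sound.partner [Finite A] {c : A → AgentState Q X Ch} (hc : Sound c) {a b b' : A} {ch : Ch}
    (ha : ∃ e ∈ (c a).prog, e.chan? = some ch) (hb : ∃ e ∈ (c b).prog, e.chan? = some ch)
    (hb' : ∃ e ∈ (c b').prog, e.chan? = some ch) (hab : a ≠ b) (hab' : a ≠ b') : b = b' := by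
  classical
  by_contra hne
  have hsub : ((({a, b, b'} : Finset A) : Set A)) ⊆
      {a | ∃ e ∈ (c a).prog, e.chan? = some ch} := by
    intro x hx
    simp only [Finset.coe_insert, Finset.coe_singleton, Set.mem_insert_iff,
      Set.mem_singleton_iff] at hx
    rcases hx with rfl | rfl | rfl
    · exact ha
    · exact hb
    · exact hb'
  have h₁ := Set.ncard_le_ncard hsub (Set.toFinite _)
  rw [Set.ncard_coe_finset, Finset.card_eq_three.2 ⟨a, b, b', hab, hab', hne, rfl⟩] at h₁
  have := hc.chan ch
  omega

/-- The qubit `x` is present in the configuration `c` or will be prepared later. -/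
def Avail (c : A → AgentState Q X Ch) (x : Q) : Prop :=
  ∃ a, x ∈ (c a).own ∨ x ∈ gather Event.prepared (c a).prog

/-- The qubits that are present in a configuration. -/
def present [Fintype A] (c : A → AgentState Q X Ch) : Finset Q :=
  Finset.univ.biUnion fun a => (c a).own

theorem mem_present [Fintype A] {c : A → AgentState Q X Ch} {x : Q} :
    x ∈ present c ↔ ∃ a, x ∈ (c a).own := by
  simp [present]

variable [DecidableEq A] [Fintype Q] [DecidableEq X]

variable {o : Finset Q} {c c' c₁ c₂ : A → AgentState Q X Ch} {L L₁ L₂ : QOp Q}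

theorem Step.agent (h : Step o c L c') (d : A) : c' d = c d ∨ ∃ e es,
    (c d).prog = e :: es ∧ (c' d).prog = es ∧ (c' d).own = e.newOwn (c d).own := by
  cases h with
  | pat a P es L Γ hprog hown hexec =>
    by_cases hd : d = a
    · subst hd
      exact .inr ⟨_, _, hprog, by simp, by simp [Event.newOwn]⟩
    · exact .inl (Function.update_of_ne hd _ _)
  | ccom a b hab ch x s v es fs ha hb hv =>
    by_cases hdb : d = b
    · subst hdb
      exact .inr ⟨_, _, hb, by simp, by simp [Event.newOwn]⟩
    by_cases hda : d = a
    · subst hda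
      exact .inr ⟨_, _, ha, by simp [hab], by simp [hab, Event.newOwn]⟩
    · exact .inl (by simp [hda, hdb])
  | qcom a b hab ch q es fs ha hb hq =>
    by_cases hdb : d = b
    · subst hdb
      exact .inr ⟨_, _, hb, by simp, by simp [Event.newOwn]⟩
    by_cases hda : d = a
    · subst hda
      exact .inr ⟨_, _, ha, by simp [hab], by simp [hab, Event.newOwn]⟩
    · exact .inl (by simp [hda, hdb])

theorem Step.prog_subset (h : Step o c L c') (d : A) {e : Event Q X Ch}
    (he : e ∈ (c' d).prog) : e ∈ (c d).prog := by
  rcases h.agent d with h | ⟨e', es, h, h', -⟩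
  · rwa [← h]
  · rw [h, ← h']
    exact List.mem_cons_of_mem _ he

theorem Step.gather_subset (h : Step o c L c') (d : A) (f : Event Q X Ch → Finset Q) {x : Q}
    (hx : x ∈ gather f (c' d).prog) : x ∈ gather f (c d).prog := by
  obtain ⟨e, he, hx⟩ := mem_gather.1 hx
  exact mem_gather.2 ⟨e, h.prog_subset d he, hx⟩

/-- The qubits that an agent will own at the end, according to its program, do not change. -/
theorem Step.foldl_newOwn (h : Step o c L c') (d : A) :
    (c' d).prog.foldl (fun S e => e.newOwn S) (c' d).own =
      (c d).prog.foldl (fun S e => e.newOwn S) (c d).own := by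
  rcases h.agent d with h | ⟨e', es, h, h', h''⟩
  · rw [h]
  · rw [h, h', h'', List.foldl_cons]

/-- The operator of a step acts on qubits of the agents that make the step. -/
theorem Step.localOn (h : Step o c L c') : ∃ N, LocalOn N L ∧ ∀ x ∈ N, ∃ a, c' a ≠ c a ∧
    (x ∈ (c a).own ∨ x ∈ gather Event.prepared (c a).prog) := by
  cases h with
  | pat a P es L Γ hprog hown hexec =>
    obtain ⟨hI, hO, hl, hc⟩ := Pattern.exec_spec hexec
    refine ⟨P.V, hl, fun x hx => ⟨a, fun e => ?_, ?_⟩⟩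
    · have := congrArg (fun s => s.prog.length) e
      simp [hprog] at this
    · by_cases hxI : x ∈ P.I
      · exact .inl (hown hxI)
      · refine .inr (mem_gather.2 ⟨.pat P, by simp [hprog], ?_⟩)
        simp [Event.prepared, hx, hxI]
  | ccom => exact ⟨∅, localOn_one _, by simp⟩
  | qcom => exact ⟨∅, localOn_one _, by simp⟩

/-- No qubit becomes available in the course of a computation: the outputs of a pattern are among
its inputs and the qubits it prepares, and a qubit that is received was owned by the sender. -/
theorem Step.avail (h : Step o c L c') {x : Q} (hx : Avail c' x) : Avail c x := by
  obtain ⟨d, hx | hx⟩ := hx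
  swap
  · exact ⟨d, .inr (h.gather_subset d _ hx)⟩
  cases h with
  | pat a P es L Γ hprog hown hexec =>
    obtain ⟨hI, hO, hl, hc⟩ := Pattern.exec_spec hexec
    by_cases hd : d = a
    · subst hd
      simp only [Function.update_self, Finset.mem_union, Finset.mem_sdiff] at hx
      rcases hx with hx | hx
      · exact ⟨d, .inl hx.1⟩
      · by_cases hxI : x ∈ P.I
        · exact ⟨d, .inl (hown hxI)⟩
        · exact ⟨d, .inr (mem_gather.2 ⟨.pat P, by simp [hprog],
            by simp [Event.prepared, hO hx, hxI]⟩)⟩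
    · rw [Function.update_of_ne hd] at hx
      exact ⟨d, .inl hx⟩
  | ccom a b hab ch y s v es fs ha hb hv =>
    by_cases hdb : d = b
    · subst hdb
      exact ⟨d, .inl (by simpa using hx)⟩
    by_cases hda : d = a
    · subst hda
      exact ⟨d, .inl (by simpa [hab] using hx)⟩
    · exact ⟨d, .inl (by simpa [hda, hdb] using hx)⟩
  | qcom a b hab ch q es fs ha hb hq =>
    by_cases hdb : d = b
    · subst hdb
      simp only [Function.update_self, Finset.mem_erase] at hx
      exact ⟨d, .inl hx.2⟩
    by_cases hda : d = a
    · subst hda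
      simp only [Function.update_of_ne hdb, Function.update_self, Finset.mem_insert] at hx
      rcases hx with rfl | hx
      · exact ⟨b, .inl hq⟩
      · exact ⟨d, .inl hx⟩
    · exact ⟨d, .inl (by simpa [hda, hdb] using hx)⟩

variable [Fintype A]

theorem Step.sum_length_lt (h : Step o c L c') :
    ∑ a, (c' a).prog.length < ∑ a, (c a).prog.length := by
  have hex : ∃ a, ∃ e es, (c a).prog = e :: es ∧ (c' a).prog = es := by
    cases h with
    | pat a P es L Γ hprog hown hexec => exact ⟨a, _, _, hprog, by simp⟩
    | ccom a b hab ch x s v es fs ha hb hv => exact ⟨b, _, _, hb, by simp⟩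
    | qcom a b hab ch q es fs ha hb hq => exact ⟨b, _, _, hb, by simp⟩
  refine Finset.sum_lt_sum (fun d _ => ?_) ?_
  · rcases h.agent d with h | ⟨e', es, h, h', -⟩
    · rw [h]
    · simp [h, h']
  · obtain ⟨a, e, es, h₁, h₂⟩ := hex
    exact ⟨a, Finset.mem_univ a, by simp [h₁, h₂]⟩

theorem Step.not_terminal (h : Step o c L c') : ¬ Terminal c := by
  intro ht
  have := h.sum_length_lt
  simp [ht _] at this

/-- Steps preserve the static conditions. -/
theorem Sound.step (hc : Sound c) (h : Step o c L c') : Sound c' := by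
  refine ⟨?_, ?_, ?_, ?_, ?_⟩
  · intro d d' x hd hd'
    cases h with
    | pat a P es L Γ hprog hown hexec =>
      obtain ⟨hI, hO, hl, hL⟩ := Pattern.exec_spec hexec
      -- New qubits of the agent `a` have been prepared by the pattern.
      have key : ∀ d, x ∈ (Function.update c a ⟨Γ, ((c a).own \ P.I) ∪ P.O, es⟩ d).own →
          x ∈ (c d).own ∨ d = a ∧ x ∈ gather Event.prepared (c a).prog := by
        intro d hd
        by_cases hda : d = a
        · subst hda
          simp only [Function.update_self, Finset.mem_union, Finset.mem_sdiff] at hd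
          rcases hd with hd | hd
          · exact .inl hd.1
          · by_cases hxI : x ∈ P.I
            · exact .inl (hown hxI)
            · exact .inr ⟨rfl, mem_gather.2 ⟨.pat P, by simp [hprog],
                by simp [Event.prepared, hO hd, hxI]⟩⟩
        · rw [Function.update_of_ne hda] at hd
          exact .inl hd
      rcases key d hd with h₁ | ⟨rfl, h₁⟩ <;> rcases key d' hd' with h₂ | ⟨rfl, h₂⟩
      · exact hc.own _ _ x h₁ h₂
      · exact absurd h₁ (hc.fresh _ _ x h₂)
      · exact absurd h₂ (hc.fresh _ _ x h₁)
      · rfl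
    | ccom a b hab ch y s v es fs ha hb hv =>
      have key : ∀ d, (Function.update (Function.update c a
          ⟨Function.update (c a).mem y (some v), (c a).own, es⟩) b
          ⟨(c b).mem, (c b).own, fs⟩ d).own = (c d).own := by
        intro d
        by_cases hdb : d = b
        · subst hdb; simp
        by_cases hda : d = a
        · subst hda; simp [hab]
        · simp [hda, hdb]
      rw [key] at hd hd'
      exact hc.own _ _ x hd hd'
    | qcom a b hab ch q es fs ha hb hq =>
      -- Only `q` changes its owner, from `b` to `a`.
      have key : ∀ d, x ∈ (Function.update (Function.update c a
          ⟨(c a).mem, insert q (c a).own, es⟩) b ⟨(c b).mem, (c b).own.erase q, fs⟩ d).own →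
          x ≠ q ∧ x ∈ (c d).own ∨ x = q ∧ d = a := by
        intro d hd
        by_cases hdb : d = b
        · subst hdb
          simp only [Function.update_self, Finset.mem_erase] at hd
          exact .inl hd
        by_cases hda : d = a
        · subst hda
          simp only [Function.update_of_ne hdb, Function.update_self, Finset.mem_insert] at hd
          by_cases hxq : x = q
          · exact .inr ⟨hxq, rfl⟩
          · exact .inl ⟨hxq, hd.resolve_left hxq⟩
        · simp only [Function.update_of_ne hdb, Function.update_of_ne hda] at hd
          exact .inl ⟨fun hxq => hdb (hc.own _ _ x hd (hxq ▸ hq)), hd⟩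
      rcases key d hd with h₁ | h₁ <;> rcases key d' hd' with h₂ | h₂
      · exact hc.own _ _ x h₁.2 h₂.2
      · exact absurd h₂.1 h₁.1
      · exact absurd h₁.1 h₂.1
      · rw [h₁.2, h₂.2]
  · intro d d' x hd hd'
    have hx := h.gather_subset d _ hd
    cases h with
    | pat a P es L Γ hprog hown hexec =>
      obtain ⟨hI, hO, hl, hL⟩ := Pattern.exec_spec hexec
      by_cases hda : d' = a
      · subst hda
        simp only [Function.update_self, Finset.mem_union, Finset.mem_sdiff] at hd'
        have h₁ : x ∉ (c d').own := hc.fresh _ _ x hx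
        have hxO : x ∈ P.O := hd'.resolve_left fun h => h₁ h.1
        have hxp : x ∈ (Event.pat P : Event Q X Ch).prepared := by
          simp only [Event.prepared, Finset.mem_sdiff]
          exact ⟨hO hxO, fun h => h₁ (hown h)⟩
        have hdd : d = d' := hc.agents _ _ x hx (mem_gather.2 ⟨.pat P, by simp [hprog], hxp⟩)
        subst hdd
        simp only [Function.update_self] at hd
        obtain ⟨f, hf, hxf⟩ := mem_gather.1 hd
        have := hc.once d
        rw [hprog, List.pairwise_cons] at this
        exact Finset.disjoint_left.1 (this.1 f hf) hxp hxf
      · rw [Function.update_of_ne hda] at hd'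
        exact hc.fresh _ _ x hx hd'
    | ccom a b hab ch y s v es fs ha hb hv =>
      by_cases hdb : d' = b
      · subst hdb
        exact hc.fresh d d' x hx (by simpa using hd')
      by_cases hda : d' = a
      · subst hda
        exact hc.fresh d d' x hx (by simpa [hab] using hd')
      · exact hc.fresh d d' x hx (by simpa [hda, hdb] using hd')
    | qcom a b hab ch q es fs ha hb hq =>
      by_cases hdb : d' = b
      · subst hdb
        simp only [Function.update_self, Finset.mem_erase] at hd'
        exact hc.fresh d d' x hx hd'.2
      by_cases hda : d' = a
      · subst hda
        simp only [Function.update_of_ne hdb, Function.update_self, Finset.mem_insert] at hd'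
        rcases hd' with rfl | hd'
        · exact hc.fresh d b x hx hq
        · exact hc.fresh d d' x hx hd'
      · exact hc.fresh d d' x hx (by simpa [hda, hdb] using hd')
  · intro d d' x hd hd'
    exact hc.agents d d' x (h.gather_subset d _ hd) (h.gather_subset d' _ hd')
  · intro d
    have := hc.once d
    rcases h.agent d with h | ⟨e', es, h, h', -⟩
    · rwa [h]
    · rw [h, List.pairwise_cons] at this
      rw [h']
      exact this.2
  · intro ch
    refine le_trans (Set.ncard_le_ncard ?_ (Set.toFinite _)) (hc.chan ch)
    rintro d ⟨e, he, hech⟩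
    exact ⟨e, h.prog_subset d he, hech⟩

/-- A step leads from states of the qubits present before it to states of those present after it.
For a pattern, the qubits of its computation space that are present are exactly its inputs. -/
theorem Sound.step_carries (hc : Sound c) (h : Step o c L c') :
    Carries (present c) (present c') L := by
  intro s t ht hst x hx
  rw [mem_present]
  cases h with
  | pat a P es L Γ hprog hown hexec =>
    obtain ⟨hI, hO, hl, hL⟩ := Pattern.exec_spec hexec
    rw [hl s t] at hst
    split_ifs at hst with hV
    · have htI : t ∩ P.V ⊆ P.I := by
        intro y hy
        rw [Finset.mem_inter] at hy
        obtain ⟨d, hd⟩ := mem_present.1 (ht hy.1)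
        by_contra hyI
        refine hc.fresh a d y (mem_gather.2 ⟨.pat P, by simp [hprog], ?_⟩) hd
        simp [Event.prepared, hy.2, hyI]
      have hsO := hL _ _ htI hst
      by_cases hxV : x ∈ P.V
      · refine ⟨a, ?_⟩
        simp [hsO (Finset.mem_inter.2 ⟨hx, hxV⟩)]
      · have hxt : x ∈ t \ P.V := hV ▸ Finset.mem_sdiff.2 ⟨hx, hxV⟩
        obtain ⟨d, hd⟩ := mem_present.1 (ht (Finset.mem_sdiff.1 hxt).1)
        refine ⟨d, ?_⟩
        by_cases hda : d = a
        · subst hda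
          simp only [Function.update_self, Finset.mem_union, Finset.mem_sdiff]
          exact .inl ⟨hd, fun h => hxV (hI h)⟩
        · rwa [Function.update_of_ne hda]
    · exact absurd rfl hst
  | ccom a b hab ch y u v es fs ha hb hv =>
    have hst' : s = t := by
      by_contra hne
      exact hst (Matrix.one_apply_ne hne)
    obtain ⟨d, hd⟩ := mem_present.1 (ht (hst' ▸ hx))
    refine ⟨d, ?_⟩
    by_cases hdb : d = b
    · subst hdb; simpa using hd
    by_cases hda : d = a
    · subst hda; simpa [hab] using hd
    · simpa [hda, hdb] using hd
  | qcom a b hab ch q es fs ha hb hq =>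
    have hst' : s = t := by
      by_contra hne
      exact hst (Matrix.one_apply_ne hne)
    obtain ⟨d, hd⟩ := mem_present.1 (ht (hst' ▸ hx))
    by_cases hxq : x = q
    · exact ⟨a, by simp [hab, hxq]⟩
    refine ⟨d, ?_⟩
    by_cases hdb : d = b
    · subst hdb; simpa [hxq] using hd
    by_cases hda : d = a
    · subst hda; simp [hab, hd]
    · simpa [hda, hdb] using hd

/-- A qubit that is to be measured remains so until it is measured; then it is gone. -/
theorem Sound.step_measured (hc : Sound c) (h : Step o c L c') {x : Q} {a : A}
    (hx : x ∈ gather Event.measured (c a).prog) :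
    x ∈ gather Event.measured (c' a).prog ∨ ¬ Avail c' x := by
  obtain ⟨e, he, hxe⟩ := mem_gather.1 hx
  rcases h.agent a with h' | ⟨e', es, h₁, h₂, -⟩
  · exact .inl (by rwa [h'])
  rw [h₁, List.mem_cons] at he
  rcases he with rfl | he
  swap
  · exact .inl (mem_gather.2 ⟨e, by rwa [h₂], hxe⟩)
  right
  have hs := hc.step h
  cases e with
  | pat P =>
    cases h with
    | pat b P' es' L Γ hprog hown hexec =>
      obtain ⟨hI, hO, hl, hL⟩ := Pattern.exec_spec hexec
      have hab : a = b := by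
        by_contra hne
        have := congrArg List.length h₁
        simp [Function.update_of_ne hne] at h₂
        simp [h₂] at this
      subst hab
      rw [hprog] at h₁
      simp only [List.cons.injEq, Event.pat.injEq] at h₁
      obtain ⟨rfl, rfl⟩ := h₁
      simp only [Event.measured, Finset.mem_sdiff] at hxe
      have hpre : ∀ y ∈ P'.V, y ∉ P'.I → y ∈ gather Event.prepared (c a).prog := by
        intro y hy hyI
        exact mem_gather.2 ⟨.pat P', by simp [hprog], by simp [Event.prepared, hy, hyI]⟩
      rintro ⟨d, hd | hd⟩
      · by_cases hda : d = a
        · subst hda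
          simp only [Function.update_self, Finset.mem_union, Finset.mem_sdiff, hxe.2,
            or_false] at hd
          exact hc.fresh _ _ x (hpre x hxe.1 hd.2) hd.1
        · rw [Function.update_of_ne hda] at hd
          by_cases hxI : x ∈ P'.I
          · exact hda (hc.own _ _ x hd (hown hxI))
          · exact hc.fresh _ _ x (hpre x hxe.1 hxI) hd
      · by_cases hxI : x ∈ P'.I
        · refine hc.fresh d a x ?_ (hown hxI)
          by_cases hda : d = a
          · subst hda
            simp only [Function.update_self] at hd
            rw [hprog]
            obtain ⟨f, hf, hxf⟩ := mem_gather.1 hd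
            exact mem_gather.2 ⟨f, List.mem_cons_of_mem _ hf, hxf⟩
          · rwa [Function.update_of_ne hda] at hd
        · by_cases hda : d = a
          · subst hda
            simp only [Function.update_self] at hd
            obtain ⟨f, hf, hxf⟩ := mem_gather.1 hd
            have := hc.once d
            rw [hprog, List.pairwise_cons] at this
            refine Finset.disjoint_left.1 (this.1 f hf) ?_ hxf
            simp [Event.prepared, hxe.1, hxI]
          · rw [Function.update_of_ne hda] at hd
            exact hda (hc.agents _ _ x hd (hpre x hxe.1 hxI))
    | ccom b b' hab ch y s v es fs ha hb hv =>
      exfalso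
      by_cases hb' : a = b'
      · subst hb'; rw [hb] at h₁; simp at h₁
      by_cases hb'' : a = b
      · subst hb''; rw [ha] at h₁; simp at h₁
      · simp only [Function.update_of_ne hb', Function.update_of_ne hb''] at h₂
        have := congrArg List.length h₁
        simp [h₂] at this
    | qcom b b' hab ch q es fs ha hb hq =>
      exfalso
      by_cases hb' : a = b'
      · subst hb'; rw [hb] at h₁; simp at h₁
      by_cases hb'' : a = b
      · subst hb''; rw [ha] at h₁; simp at h₁
      · simp only [Function.update_of_ne hb', Function.update_of_ne hb''] at h₂
        have := congrArg List.length h₁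
        simp [h₂] at this
  | csend ch s => simp [Event.measured] at hxe
  | crecv ch s => simp [Event.measured] at hxe
  | qsend ch s => simp [Event.measured] at hxe
  | qrecv ch s => simp [Event.measured] at hxe

end Confluence

/-! ### Computation paths and confluence -/

section Paths

variable {A Q X Ch : Type*} [DecidableEq A] [Fintype Q] [DecidableEq Q] [DecidableEq X]
  {o : Finset Q} {c c' c₁ c₂ t : A → AgentState Q X Ch} {K L L₁ L₂ : QOp Q}

open Classical in
/-- A step depends only on the agents that make it. -/
theorem Step.transport (h : Step o c L c') {d : A → AgentState Q X Ch}
    (hd : ∀ a, c' a ≠ c a → d a = c a) :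
    Step o d L fun a => if c' a = c a then d a else c' a := by
  cases h with
  | pat a P es L Γ hprog hown hexec =>
    have hne : (Function.update c a ⟨Γ, ((c a).own \ P.I) ∪ P.O, es⟩) a ≠ c a := fun e => by
      have := congrArg (fun s => s.prog.length) e
      simp [hprog] at this
    have hda := hd a hne
    rw [← hda] at hprog hown hexec
    convert Step.pat d a P es L Γ hprog hown hexec using 1
    funext x
    by_cases hx : x = a
    · subst hx
      rw [if_neg hne]
      simp [hda]
    · simp [hx]
  | ccom a b hab ch y s v es fs ha hb hv =>
    have hnb : (Function.update (Function.update c a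
        ⟨Function.update (c a).mem y (some v), (c a).own, es⟩) b
          ⟨(c b).mem, (c b).own, fs⟩) b ≠ c b := fun e => by
      have := congrArg (fun s => s.prog.length) e
      simp [hb] at this
    have hna : (Function.update (Function.update c a
        ⟨Function.update (c a).mem y (some v), (c a).own, es⟩) b
          ⟨(c b).mem, (c b).own, fs⟩) a ≠ c a := fun e => by
      have := congrArg (fun s => s.prog.length) e
      simp [hab, ha] at this
    have hda := hd a hna
    have hdb := hd b hnb
    rw [← hda] at ha
    rw [← hdb] at hb hv
    convert Step.ccom d a b hab ch y s v es fs ha hb hv using 1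
    funext x
    by_cases hxb : x = b
    · subst hxb
      rw [if_neg hnb]
      simp [hdb]
    by_cases hxa : x = a
    · subst hxa
      rw [if_neg hna]
      simp [hda, hab]
    · simp [hxa, hxb]
  | qcom a b hab ch q es fs ha hb hq =>
    have hnb : (Function.update (Function.update c a
        ⟨(c a).mem, insert q (c a).own, es⟩) b
          ⟨(c b).mem, (c b).own.erase q, fs⟩) b ≠ c b := fun e => by
      have := congrArg (fun s => s.prog.length) e
      simp [hb] at this
    have hna : (Function.update (Function.update c a
        ⟨(c a).mem, insert q (c a).own, es⟩) b
          ⟨(c b).mem, (c b).own.erase q, fs⟩) a ≠ c a := fun e => by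
      have := congrArg (fun s => s.prog.length) e
      simp [hab, ha] at this
    have hda := hd a hna
    have hdb := hd b hnb
    rw [← hda] at ha
    rw [← hdb] at hb hq
    convert Step.qcom d a b hab ch q es fs ha hb hq using 1
    funext x
    by_cases hxb : x = b
    · subst hxb
      rw [if_neg hnb]
      simp [hdb]
    by_cases hxa : x = a
    · subst hxa
      rw [if_neg hna]
      simp [hda, hab]
    · simp [hxa, hxb]

theorem Path.trans (h : Path o c K c₁) (h' : Path o c₁ L c₂) : Path o c (L * K) c₂ := by
  induction h' with
  | refl => rwa [Matrix.one_mul]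
  | tail c' c'' L M hp hs ih =>
    rw [Matrix.mul_assoc]
    exact Path.tail _ _ _ _ _ ih hs

theorem Step.path (h : Step o c L c') : Path o c L c' := by
  simpa using Path.tail _ _ _ _ _ (Path.refl c) h

theorem Path.head_cases (h : Path o c K c') :
    (c' = c ∧ K = 1) ∨ ∃ L₀ c₀ K₀, Step o c L₀ c₀ ∧ Path o c₀ K₀ c' ∧ K = K₀ * L₀ := by
  induction h with
  | refl => exact .inl ⟨rfl, rfl⟩
  | tail c' c'' K L hp hs ih =>
    right
    rcases ih with ⟨rfl, rfl⟩ | ⟨L₀, c₀, K₀, h₀, hp₀, rfl⟩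
    · exact ⟨L, c'', 1, hs, Path.refl _, by simp⟩
    · exact ⟨L₀, c₀, L * K₀, h₀, Path.tail _ _ _ _ _ hp₀ hs, by rw [Matrix.mul_assoc]⟩

theorem Path.avail (h : Path o c K c') {x : Q} (hx : Avail c' x) : Avail c x := by
  induction h with
  | refl => exact hx
  | tail c' c'' K L hp hs ih => exact ih (hs.avail hx)

theorem Path.foldl_newOwn (h : Path o c K c') (d : A) :
    (c' d).prog.foldl (fun S e => e.newOwn S) (c' d).own =
      (c d).prog.foldl (fun S e => e.newOwn S) (c d).own := by
  induction h with
  | refl => rfl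
  | tail c' c'' K L hp hs ih => rw [hs.foldl_newOwn, ih]

theorem Path.localOn (h : Path o c K c') {N : Finset Q} (hN : ∀ x, Avail c x → x ∈ N) :
    LocalOn N K := by
  induction h with
  | refl => exact localOn_one N
  | tail c' c'' K L hp hs ih =>
    obtain ⟨M, hM, hMN⟩ := hs.localOn
    refine (hM.mono fun x hx => hN x (hp.avail ?_)).mul ih
    obtain ⟨a, -, ha⟩ := hMN x hx
    exact ⟨a, ha⟩

/-- The outcomes of qubits that are not measured any more are irrelevant. -/
theorem Path.congr_outcomes {o' : Finset Q} (h : Path o c K c')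
    (ho : ∀ a, ∀ x ∈ gather Event.measured (c a).prog, x ∈ o ↔ x ∈ o') : Path o' c K c' := by
  have key : Path o' c K c' ∧
      ∀ a, ∀ x ∈ gather Event.measured (c' a).prog, x ∈ o ↔ x ∈ o' := by
    induction h with
    | refl => exact ⟨Path.refl _, ho⟩
    | tail c' c'' K L hp hs ih =>
      obtain ⟨hp', ho'⟩ := ih
      refine ⟨Path.tail _ _ _ _ _ hp' ?_, fun a x hx => ho' a x (hs.gather_subset a _ hx)⟩
      cases hs with
      | pat a P es L Γ hprog hown hexec =>
        exact Step.pat _ a P es L Γ hprog hown (Pattern.exec_congr hexec fun i hi =>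
          ho' a i (mem_gather.2 ⟨.pat P, by simp [hprog], hi⟩))
      | ccom a b hab ch y s v es fs ha hb hv =>
        exact Step.ccom _ a b hab ch y s v es fs ha hb hv
      | qcom a b hab ch q es fs ha hb hq => exact Step.qcom _ a b hab ch q es fs ha hb hq
  exact key.1

variable [Fintype A]

theorem Sound.path (hc : Sound c) (h : Path o c K c') : Sound c' := by
  induction h with
  | refl => exact hc
  | tail c' c'' K L hp hs ih => exact ih.step hs

theorem Sound.path_carries (hc : Sound c) (h : Path o c K c') :
    Carries (present c) (present c') K := by
  induction h with
  | refl => exact carries_one _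
  | tail c' c'' K L hp hs ih => exact ((hc.path hp).step_carries hs).mul ih

/-- The qubits that a terminating computation measures are not present at its end. -/
theorem Sound.not_present_of_measured (hc : Sound c) (h : Path o c K t) (ht : Terminal t)
    {x : Q} {a : A} (hx : x ∈ gather Event.measured (c a).prog) : x ∉ present t := by
  have key : x ∈ gather Event.measured (t a).prog ∨ ¬ Avail t x := by
    clear ht
    induction h with
    | refl => exact .inl hx
    | tail c' c'' K L hp hs ih =>
      rcases ih with ih | ih
      · exact (hc.path hp).step_measured hs ih
      · exact .inr fun h => ih (hs.avail h)
  rw [ht a] at key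
  intro hp
  obtain ⟨d, hd⟩ := mem_present.1 hp
  exact key.elim (by simp [gather]) fun h => h ⟨d, .inl hd⟩

/-- Two steps in which the same agent takes part are equal: its next event determines the step,
since a channel joins only two agents. -/
theorem Sound.eq_of_common (hc : Sound c) (h₁ : Step o c L₁ c₁) (h₂ : Step o c L₂ c₂) {d : A}
    (hd₁ : c₁ d ≠ c d) (hd₂ : c₂ d ≠ c d) : L₁ = L₂ ∧ c₁ = c₂ := by
  have upd : ∀ {a b : A} {x y : AgentState Q X Ch},
      Function.update (Function.update c a x) b y d ≠ c d → d = a ∨ d = b := by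
    intro a b x y h
    by_contra hn
    rw [not_or] at hn
    simp [hn.1, hn.2] at h
  have upd' : ∀ {a : A} {x : AgentState Q X Ch}, Function.update c a x d ≠ c d → d = a := by
    intro a x h
    by_contra hn
    simp [hn] at h
  have head : ∀ {a : A} {e f : Event Q X Ch} {es fs : List (Event Q X Ch)},
      (c a).prog = e :: es → (c a).prog = f :: fs → e = f ∧ es = fs := by
    intro a e f es fs h h'
    rw [h] at h'
    simpa using h'
  have use : ∀ {a : A} {e : Event Q X Ch} {es : List (Event Q X Ch)} {ch : Ch},
      (c a).prog = e :: es → e.chan? = some ch → ∃ e ∈ (c a).prog, e.chan? = some ch :=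
    fun h h' => ⟨_, by rw [h]; exact List.mem_cons_self, h'⟩
  cases h₁ with
  | pat a P es L Γ hprog hown hexec =>
    have := upd' hd₁
    subst this
    cases h₂ with
    | pat a' P' es' L' Γ' hprog' hown' hexec' =>
      have := upd' hd₂
      subst this
      obtain ⟨h, rfl⟩ := head hprog hprog'
      simp only [Event.pat.injEq] at h
      subst h
      rw [hexec] at hexec'
      simp only [Option.some.injEq, Prod.mk.injEq] at hexec'
      obtain ⟨rfl, rfl⟩ := hexec'
      exact ⟨rfl, rfl⟩
    | ccom a' b' hab' ch' y' s' v' es' fs' ha' hb' hv' =>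
      rcases upd hd₂ with rfl | rfl
      · simpa using (head hprog ha').1
      · simpa using (head hprog hb').1
    | qcom a' b' hab' ch' q' es' fs' ha' hb' hq' =>
      rcases upd hd₂ with rfl | rfl
      · simpa using (head hprog ha').1
      · simpa using (head hprog hb').1
  | ccom a b hab ch y s v es fs ha hb hv =>
    cases h₂ with
    | pat a' P' es' L' Γ' hprog' hown' hexec' =>
      have := upd' hd₂
      subst this
      rcases upd hd₁ with rfl | rfl
      · simpa using (head hprog' ha).1
      · simpa using (head hprog' hb).1
    | ccom a' b' hab' ch' y' s' v' es' fs' ha' hb' hv' =>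
      have hkey : a = a' ∧ b = b' := by
        rcases upd hd₁ with rfl | rfl <;> rcases upd hd₂ with rfl | rfl
        · have h := (head ha ha').1
          simp only [Event.crecv.injEq] at h
          obtain ⟨rfl, -⟩ := h
          exact ⟨rfl, hc.partner (use ha rfl) (use hb rfl) (use hb' rfl) hab hab'⟩
        · simpa using (head ha hb').1
        · simpa using (head hb ha').1
        · have h := (head hb hb').1
          simp only [Event.csend.injEq] at h
          obtain ⟨rfl, -⟩ := h
          exact ⟨hc.partner (use hb rfl) (use ha rfl) (use ha' rfl) hab.symm hab'.symm, rfl⟩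
      obtain ⟨rfl, rfl⟩ := hkey
      obtain ⟨h, rfl⟩ := head ha ha'
      obtain ⟨h', rfl⟩ := head hb hb'
      simp only [Event.crecv.injEq] at h
      simp only [Event.csend.injEq] at h'
      obtain ⟨rfl, rfl⟩ := h
      obtain ⟨-, rfl⟩ := h'
      rw [hv] at hv'
      simp only [Option.some.injEq] at hv'
      subst hv'
      exact ⟨rfl, rfl⟩
    | qcom a' b' hab' ch' q' es' fs' ha' hb' hq' =>
      rcases upd hd₁ with rfl | rfl <;> rcases upd hd₂ with rfl | rfl
      · simpa using (head ha ha').1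
      · simpa using (head ha hb').1
      · simpa using (head hb ha').1
      · simpa using (head hb hb').1
  | qcom a b hab ch q es fs ha hb hq =>
    cases h₂ with
    | pat a' P' es' L' Γ' hprog' hown' hexec' =>
      have := upd' hd₂
      subst this
      rcases upd hd₁ with rfl | rfl
      · simpa using (head hprog' ha).1
      · simpa using (head hprog' hb).1
    | ccom a' b' hab' ch' y' s' v' es' fs' ha' hb' hv' =>
      rcases upd hd₁ with rfl | rfl <;> rcases upd hd₂ with rfl | rfl
      · simpa using (head ha ha').1
      · simpa using (head ha hb').1
      · simpa using (head hb ha').1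
      · simpa using (head hb hb').1
    | qcom a' b' hab' ch' q' es' fs' ha' hb' hq' =>
      have hkey : a = a' ∧ b = b' := by
        rcases upd hd₁ with rfl | rfl <;> rcases upd hd₂ with rfl | rfl
        · have h := (head ha ha').1
          simp only [Event.qrecv.injEq] at h
          obtain ⟨rfl, -⟩ := h
          exact ⟨rfl, hc.partner (use ha rfl) (use hb rfl) (use hb' rfl) hab hab'⟩
        · simpa using (head ha hb').1
        · simpa using (head hb ha').1
        · have h := (head hb hb').1
          simp only [Event.qsend.injEq] at h
          obtain ⟨rfl, -⟩ := h
          exact ⟨hc.partner (use hb rfl) (use ha rfl) (use ha' rfl) hab.symm hab'.symm, rfl⟩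
      obtain ⟨rfl, rfl⟩ := hkey
      obtain ⟨h, rfl⟩ := head ha ha'
      obtain ⟨h', rfl⟩ := head hb hb'
      simp only [Event.qrecv.injEq] at h
      obtain ⟨rfl, rfl⟩ := h
      exact ⟨rfl, rfl⟩

/-- The diamond property.  Two different steps are made by disjoint sets of agents, so that they
can be executed one after the other in both orders, and their operators commute. -/
theorem Sound.diamond (hc : Sound c) (h₁ : Step o c L₁ c₁) (h₂ : Step o c L₂ c₂) :
    (L₁ = L₂ ∧ c₁ = c₂) ∨ (L₂ * L₁ = L₁ * L₂ ∧ ∃ d, Step o c₁ L₂ d ∧ Step o c₂ L₁ d) := by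
  classical
  by_cases hd : ∃ d, c₁ d ≠ c d ∧ c₂ d ≠ c d
  · obtain ⟨d, hd₁, hd₂⟩ := hd
    exact .inl (hc.eq_of_common h₁ h₂ hd₁ hd₂)
  have hd : ∀ d, c₁ d = c d ∨ c₂ d = c d := by
    intro d
    by_contra h
    exact hd ⟨d, not_or.1 h⟩
  right
  constructor
  · obtain ⟨N₁, hN₁, hq₁⟩ := h₁.localOn
    obtain ⟨N₂, hN₂, hq₂⟩ := h₂.localOn
    refine hN₂.commute hN₁ (Finset.disjoint_left.2 fun x hx₂ hx₁ => ?_)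
    obtain ⟨a, ha, hxa⟩ := hq₁ x hx₁
    obtain ⟨b, hb, hxb⟩ := hq₂ x hx₂
    have hab : a = b := by
      rcases hxa with hxa | hxa <;> rcases hxb with hxb | hxb
      · exact hc.own _ _ x hxa hxb
      · exact absurd hxa (hc.fresh _ _ x hxb)
      · exact absurd hxb (hc.fresh _ _ x hxa)
      · exact hc.agents _ _ x hxa hxb
    subst hab
    exact (hd a).elim ha hb
  · refine ⟨_, h₂.transport fun a ha => (hd a).resolve_right ha, ?_⟩
    convert h₁.transport fun a ha => (hd a).resolve_left ha using 1
    funext a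
    rcases hd a with ha | ha
    · simp only [ha, if_true]
      split_ifs with h
      · rw [h]
      · rfl
    · simp only [ha, if_true]
      split_ifs with h
      · rw [h]
      · rfl

/-- If a computation from `c` terminates in `t`, then after any other first step the computation
can still be continued to `t`, with the same total operator. -/
theorem Sound.step_completes (hc : Sound c) (h : Path o c K t) (ht : Terminal t)
    (hs : Step o c L c') : ∃ K', Path o c' K' t ∧ K = K' * L := by
  induction hn : ∑ a, (c a).prog.length using Nat.strong_induction_on generalizing c c' K L with
  | _ n ih =>
    rcases h.head_cases with ⟨rfl, -⟩ | ⟨L₀, c₀, K₀, h₀, hp₀, rfl⟩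
    · exact absurd ht hs.not_terminal
    rcases hc.diamond h₀ hs with ⟨rfl, rfl⟩ | ⟨hcomm, d, hd₀, hd⟩
    · exact ⟨K₀, hp₀, rfl⟩
    · obtain ⟨K', hK', rfl⟩ := ih _ (hn ▸ h₀.sum_length_lt) (hc.step h₀) hp₀ hd₀ rfl
      exact ⟨K' * L₀, hd.path.trans hK', by rw [Matrix.mul_assoc, Matrix.mul_assoc, hcomm]⟩

/-- Confluence: if some computation from `c` terminates in `t`, then every computation from `c` can
be continued to `t`, with the same total operator. -/
theorem Sound.completes (hc : Sound c) (h : Path o c K t) (ht : Terminal t)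
    (hp : Path o c L c') : ∃ K', Path o c' K' t ∧ K = K' * L := by
  induction hp with
  | refl => exact ⟨K, h, by simp⟩
  | tail c' c'' L M hp hs ih =>
    obtain ⟨K', hK', rfl⟩ := ih
    obtain ⟨K'', hK'', rfl⟩ := (hc.path hp).step_completes hK' ht hs
    exact ⟨K'', hK'', by rw [Matrix.mul_assoc]⟩

theorem Path.eq_of_terminal (h : Path o c K c') (hc : Terminal c) : c' = c ∧ K = 1 := by
  rcases h.head_cases with h | ⟨L₀, c₀, K₀, h₀, -⟩
  · exact h
  · exact absurd hc h₀.not_terminal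

theorem Sound.terminal_unique (hc : Sound c) (h : Path o c K t) (ht : Terminal t)
    (hp : Path o c L c') (hc' : Terminal c') : c' = t ∧ L = K := by
  obtain ⟨K', hK', rfl⟩ := hc.completes h ht hp
  obtain ⟨rfl, rfl⟩ := hK'.eq_of_terminal hc'
  exact ⟨rfl, by simp⟩

end Paths

/-! ### Branches and the two semantics of a network -/

section Weighted

variable {A Q X : Type*}

theorem ptsComp_apply (G F : PState A Q X → PState A Q X →₀ ℝ) (s : PState A Q X) :
    ptsComp G F s = Finsupp.linearCombination ℝ G (F s) := rfl

variable [Fintype Q]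

/-- The point distribution at the normalisation of a state, weighted with the trace. -/
noncomputable def weightedPoint (κ : A → Mem Q X) (ρ : QOp Q) : PState A Q X →₀ ℝ :=
  Finsupp.single (κ, (ρ.trace)⁻¹ • ρ) ρ.trace.re

/-- For `r = 0` both sides vanish, because the weight does. -/
theorem weightedPoint_smul (κ : A → Mem Q X) (ρ : QOp Q) (r : ℝ) :
    weightedPoint κ ((r : ℂ) • ρ) = r • weightedPoint κ ρ := by
  by_cases hr : r = 0
  · simp [hr, weightedPoint]
  · have hr' : (r : ℂ) ≠ 0 := by exact_mod_cast hr
    have h : ((r : ℂ) • ρ).trace⁻¹ • ((r : ℂ) • ρ) = (ρ.trace)⁻¹ • ρ := by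
      rw [Matrix.trace_smul, smul_smul, smul_eq_mul]
      congr 1
      field_simp
    rw [weightedPoint, h, weightedPoint, Finsupp.smul_single, Matrix.trace_smul]
    simp

theorem ofReal_re_trace {ρ : QOp Q} (hρ : ρ.PosSemidef) : (ρ.trace.re : ℂ) = ρ.trace :=
  (Complex.eq_re_of_ofReal_le (r := 0) (by simpa using hρ.trace_nonneg)).symm

end Weighted

section OpPaths

variable {A Q X Ch : Type*} [DecidableEq A] [Fintype Q] [DecidableEq Q] [DecidableEq X]
  {o : Finset Q} {c c' : A → AgentState Q X Ch}

/-- The transition probabilities along a computation multiply to the trace of the final state.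
If an intermediate state vanishes, then so do all later ones, and both sides are `0`. -/
theorem OpPath.exists_path {ρ ρ' : QOp Q} {p : ℝ} (h : OpPath o ρ c p ρ' c')
    (hρ : ρ.PosSemidef) (htr : ρ.trace = 1) :
    ∃ K, Path o c K c' ∧ ρ' = K * ρ * Kᴴ ∧ p = ρ'.trace.re := by
  induction h with
  | refl c => exact ⟨1, Path.refl _, by simp, by simp [htr]⟩
  | tail ρ' c c' c'' p L hp hs ih =>
    obtain ⟨K, hK, hρ', rfl⟩ := ih
    refine ⟨L * K, Path.tail _ _ _ _ _ hK hs, ?_, ?_⟩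
    · rw [hρ', Matrix.conjTranspose_mul]
      simp only [Matrix.mul_assoc]
    · by_cases h0 : ρ'.trace.re = 0
      · have hps : ρ'.PosSemidef := hρ' ▸ hρ.mul_mul_conjTranspose_same K
        have htr0 : ρ'.trace = 0 := by rw [← ofReal_re_trace hps, h0, Complex.ofReal_zero]
        have hz : ρ' = 0 := hps.trace_eq_zero_iff.1 htr0
        rw [h0, hz]
        simp
      · exact mul_div_cancel₀ _ h0

theorem Path.exists_opPath {K : QOp Q} (h : Path o c K c') (ρ : QOp Q) :
    ∃ p, OpPath o ρ c p (K * ρ * Kᴴ) c' := by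
  induction h with
  | refl => exact ⟨1, by simpa using OpPath.refl ρ c⟩
  | tail c' c'' K L hp hs ih =>
    obtain ⟨p, hp⟩ := ih
    have := OpPath.tail _ _ _ _ _ _ _ hp hs
    rw [Matrix.conjTranspose_mul]
    simp only [Matrix.mul_assoc] at this ⊢
    exact ⟨_, this⟩

end OpPaths

namespace Network

variable {A Q X Ch : Type*}

theorem exists_classicalInput (N : Network A Q X Ch) : ∃ κ, N.ClassicalInput κ := by
  classical
  refine ⟨fun a r => if r ∈ (N.ag a).cin then some false else none, fun a r => ?_⟩
  by_cases hr : r ∈ (N.ag a).cin <;> simp [hr]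

variable [DecidableEq Q] {N : Network A Q X Ch} {κ : A → Mem Q X}

section Registers

variable [Fintype A]

theorem disjoint_inReg_res (N : Network A Q X Ch) : Disjoint N.inReg N.res := by
  rw [inReg, Finset.disjoint_biUnion_left]
  exact fun a _ => Finset.sdiff_disjoint

theorem mem_names {x : Q} : x ∈ N.names ↔
    ∃ a, x ∈ (N.ag a).own ∨ x ∈ gather Event.space (N.ag a).prog := by
  simp [names]

theorem mem_names_of_avail {x : Q} (hx : Avail (N.init κ) x) : x ∈ N.names := by
  obtain ⟨a, hx⟩ := hx
  exact mem_names.2 ⟨a, hx.imp id fun h => gather_prepared_subset_space h⟩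

theorem meas_subset_names (N : Network A Q X Ch) : N.meas ⊆ N.names := by
  intro x hx
  simp only [meas, Finset.mem_biUnion, Finset.mem_univ, true_and] at hx
  obtain ⟨a, ha⟩ := hx
  exact mem_names.2 ⟨a, .inr (gather_measured_subset_space ha)⟩

theorem inReg_subset_names (N : Network A Q X Ch) : N.inReg ⊆ N.names := by
  intro x hx
  simp only [inReg, sig, Finset.mem_biUnion, Finset.mem_univ, true_and, Finset.mem_sdiff] at hx
  obtain ⟨a, ha, -⟩ := hx
  exact mem_names.2 ⟨a, .inl ha⟩

theorem own_subset_names (N : Network A Q X Ch) (a : A) : (N.ag a).own ⊆ N.names :=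
  fun _ hx => mem_names.2 ⟨a, .inl hx⟩

theorem prepared_subset_names (N : Network A Q X Ch) (a : A) :
    gather Event.prepared (N.ag a).prog ⊆ N.names :=
  fun _ hx => mem_names.2 ⟨a, .inr (gather_prepared_subset_space hx)⟩

end Registers

variable [Fintype Q]

/-- The static definiteness conditions. -/
structure Static (N : Network A Q X Ch) : Prop where
  res_subset : ∀ q ∈ N.res, ∃ a, q ∈ (N.ag a).own
  density : IsDensity N.res N.σ
  own_disjoint : ∀ a b, a ≠ b → Disjoint (N.ag a).own (N.ag b).own
  prepared_new : ∀ a b, Disjoint (gather Event.prepared (N.ag a).prog) (N.ag b).own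
  prepared_agents : ∀ a b, a ≠ b →
    Disjoint (gather Event.prepared (N.ag a).prog) (gather Event.prepared (N.ag b).prog)
  prepared_once : ∀ a, (N.ag a).prog.Pairwise fun e f => Disjoint e.prepared f.prepared
  channels : ∀ ch, {a | N.Uses a ch}.ncard ≤ 2

theorem Static.sound (h : N.Static) (κ : A → Mem Q X) : Sound (N.init κ) where
  own a b x ha hb := by
    by_contra hab
    exact Finset.disjoint_left.1 (h.own_disjoint a b hab) ha hb
  fresh a b x ha hb := Finset.disjoint_left.1 (h.prepared_new a b) ha hb
  agents a b x ha hb := by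
    by_contra hab
    exact Finset.disjoint_left.1 (h.prepared_agents a b hab) ha hb
  once := h.prepared_once
  chan := h.channels

theorem Static.present_init [Fintype A] (h : N.Static) (κ : A → Mem Q X) :
    present (N.init κ) = N.inReg ∪ N.res := by
  ext x
  simp only [mem_present, inReg, sig, init, Finset.mem_union, Finset.mem_biUnion,
    Finset.mem_univ, true_and, Finset.mem_sdiff]
  constructor
  · rintro ⟨a, ha⟩
    by_cases hx : x ∈ N.res
    · exact .inr hx
    · exact .inl ⟨a, ha, hx⟩
  · rintro (⟨a, ha, -⟩ | hx)
    · exact ⟨a, ha⟩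
    · exact h.res_subset x hx

theorem Static.res_subset_names [Fintype A] (h : N.Static) : N.res ⊆ N.names := by
  intro x hx
  obtain ⟨a, ha⟩ := h.res_subset x hx
  exact mem_names.2 ⟨a, .inl ha⟩

variable [DecidableEq A] [DecidableEq X]

/-- From the classical inputs `κ`, the branch with outcomes `o` terminates in `t` with the total
operator `K`. -/
structure Completes (N : Network A Q X Ch) (κ : A → Mem Q X) (o : Finset Q) (K : QOp Q)
    (t : A → AgentState Q X Ch) : Prop where
  input : N.ClassicalInput κ
  path : Path o (N.init κ) K t
  terminal : Terminal t

variable {o : Finset Q} {K K' : QOp Q} {t t' : A → AgentState Q X Ch}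

theorem WellDefined.static (h : N.WellDefined) : N.Static :=
  ⟨h.res_subset, h.density, h.own_disjoint, h.prepared_new, h.prepared_agents, h.prepared_once,
    h.channels⟩

theorem Completes.own_eq (hC : N.Completes κ o K t) (a : A) : (t a).own = N.sig.qout a := by
  have := hC.path.foldl_newOwn a
  rw [hC.terminal a] at this
  exact this

theorem branchOp_eq_zero (hκ : ¬ N.ClassicalInput κ) (κ' : A → Mem Q X) :
    N.branchOp κ o κ' = 0 := by
  unfold branchOp
  rw [dif_neg]
  rintro ⟨K, hK, -⟩
  exact hκ hK

variable [Fintype A]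

/-- To establish progress it suffices to find, for every branch, one computation that terminates
with all outputs: by confluence every other computation can be continued to the same end. -/
theorem Static.wellDefined (h : N.Static) (hN : ∀ κ, N.ClassicalInput κ → ∀ o, ∃ K t,
    N.Completes κ o K t ∧ ∀ a, ∀ r ∈ (N.ag a).cout, ((t a).mem r).isSome) : N.WellDefined where
  res_subset := h.res_subset
  density := h.density
  own_disjoint := h.own_disjoint
  prepared_new := h.prepared_new
  prepared_agents := h.prepared_agents
  prepared_once := h.prepared_once
  channels := h.channels
  progress κ hκ o L c hc := by
    obtain ⟨K, t, ht, hout⟩ := hN κ hκ o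
    obtain ⟨K', hK', -⟩ := (h.sound κ).completes ht.path ht.terminal hc
    rcases hK'.head_cases with ⟨rfl, -⟩ | ⟨L₀, c₀, K₀, h₀, -⟩
    · exact .inr ⟨ht.terminal, hout⟩
    · exact .inl ⟨L₀, c₀, h₀⟩

/-- Computations terminate, since every step shortens a program. -/
theorem WellDefined.exists_completes (h : N.WellDefined) (hκ : N.ClassicalInput κ)
    (o : Finset Q) : ∃ K t, N.Completes κ o K t := by
  suffices ∀ n K c, Path o (N.init κ) K c → ∑ a, (c a).prog.length = n →
      ∃ K t, N.Completes κ o K t from this _ _ _ (Path.refl _) rfl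
  intro n
  induction n using Nat.strong_induction_on with
  | _ n ih =>
    intro K c hc hn
    rcases h.progress κ hκ o K c hc with ⟨L, c', hs⟩ | ⟨ht, -⟩
    · exact ih _ (hn ▸ hs.sum_length_lt) _ c' (hc.tail _ _ _ _ _ hs) rfl
    · exact ⟨K, c, hκ, hc, ht⟩

theorem Completes.isSome_mem (hC : N.Completes κ o K t) (h : N.WellDefined) {a : A}
    {r : Ref Q X} (hr : r ∈ (N.ag a).cout) : ((t a).mem r).isSome := by
  rcases h.progress κ hC.input o K t hC.path with ⟨L, c', hs⟩ | ⟨-, h⟩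
  · exact absurd hC.terminal hs.not_terminal
  · exact h a r hr

theorem Completes.isSome_output (hC : N.Completes κ o K t) (h : N.WellDefined) (a : A)
    (r : Ref Q X) : (N.output t a r).isSome ↔ r ∈ (N.ag a).cout := by
  unfold output
  split_ifs with hr
  · exact iff_of_true (hC.isSome_mem h hr) hr
  · simp [hr]

theorem Completes.unique (hC : N.Completes κ o K t) (h : N.WellDefined)
    (hC' : N.Completes κ o K' t') : t' = t ∧ K' = K :=
  (h.static.sound κ).terminal_unique hC.path hC.terminal hC'.path hC'.terminal

theorem Completes.congr_outcomes (hC : N.Completes κ o K t) {o' : Finset Q}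
    (ho : ∀ x ∈ N.meas, x ∈ o ↔ x ∈ o') : N.Completes κ o' K t :=
  ⟨hC.input, hC.path.congr_outcomes fun a x hx =>
    ho x (Finset.mem_biUnion.2 ⟨a, Finset.mem_univ a, hx⟩), hC.terminal⟩

theorem Completes.present_eq (hC : N.Completes κ o K t) : present t = N.outReg := by
  ext x
  simp [present, outReg, hC.own_eq]

theorem WellDefined.outReg_subset_names (h : N.WellDefined) : N.outReg ⊆ N.names := by
  obtain ⟨κ, hκ⟩ := N.exists_classicalInput
  obtain ⟨K, t, hC⟩ := h.exists_completes hκ ∅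
  intro x hx
  rw [← hC.present_eq] at hx
  obtain ⟨a, ha⟩ := mem_present.1 hx
  exact mem_names_of_avail (hC.path.avail ⟨a, .inl ha⟩)

theorem WellDefined.disjoint_meas_outReg (h : N.WellDefined) : Disjoint N.meas N.outReg := by
  obtain ⟨κ, hκ⟩ := N.exists_classicalInput
  obtain ⟨K, t, hC⟩ := h.exists_completes hκ ∅
  rw [← hC.present_eq, Finset.disjoint_left]
  intro x hx
  simp only [meas, Finset.mem_biUnion, Finset.mem_univ, true_and] at hx
  obtain ⟨a, ha⟩ := hx
  exact (h.static.sound κ).not_present_of_measured hC.path hC.terminal (a := a) ha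

theorem Completes.localOn (hC : N.Completes κ o K t) : LocalOn N.names K :=
  hC.path.localOn fun _ => mem_names_of_avail

theorem Completes.carries (hC : N.Completes κ o K t) (h : N.WellDefined) :
    Carries (N.inReg ∪ N.res) N.outReg K := by
  rw [← hC.present_eq, ← h.static.present_init κ]
  exact (h.static.sound κ).path_carries hC.path

theorem Completes.branchOp_eq [DecidableEq (A → Mem Q X)] (hC : N.Completes κ o K t)
    (h : N.WellDefined) (κ' : A → Mem Q X) :
    N.branchOp κ o κ' = if κ' = N.output t then K else 0 := by
  unfold branchOp
  split_ifs with hb hκ' hκ'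
  · obtain ⟨-, c, hc, hct, -⟩ := hb.choose_spec
    exact (hC.unique h ⟨hC.input, hc, hct⟩).2
  · obtain ⟨-, c, hc, hct, hout⟩ := hb.choose_spec
    rw [(hC.unique h ⟨hC.input, hc, hct⟩).1] at hout
    exact absurd hout hκ'
  · exact absurd ⟨K, hC.input, t, hC.path, hC.terminal, hκ'⟩ hb
  · rfl

theorem den_apply (κ κ' : A → Mem Q X) (ρ : QOp Q) : N.den κ κ' ρ = ∑ o ∈ N.meas.powerset,
    N.branchOp κ o κ' * DMC.tensor N.inReg N.res ρ N.σ * (N.branchOp κ o κ')ᴴ := rfl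

theorem den_eq_zero (hκ : ¬ N.ClassicalInput κ) (κ' : A → Mem Q X) : N.den κ κ' = 0 := by
  ext ρ : 1
  simp [den_apply, branchOp_eq_zero hκ]

theorem WellDefined.isCPM_den (h : N.WellDefined) (κ κ' : A → Mem Q X) :
    IsCPM N.inReg N.outReg (N.den κ κ') := by
  classical
  refine isCPM_of_kraus N.meas.powerset h.density.1 (fun o _ => ?_) (den_apply κ κ')
  by_cases hκ : N.ClassicalInput κ
  · obtain ⟨K, t, hC⟩ := h.exists_completes hκ o
    rw [hC.branchOp_eq h]
    split_ifs
    · exact hC.carries h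
    · exact fun b c _ h => absurd rfl h
  · rw [branchOp_eq_zero hκ]
    exact fun b c _ h => absurd rfl h

theorem Completes.opBranch_iff (hC : N.Completes κ o K t) (h : N.WellDefined) {ρ : QOp Q}
    (hρ : IsDensity N.inReg ρ) {p : ℝ} {u : PState A Q X} :
    N.OpBranch (κ, ρ) o p u ↔
      p = (K * DMC.tensor N.inReg N.res ρ N.σ * Kᴴ).trace.re ∧
      u = (N.output t, ((K * DMC.tensor N.inReg N.res ρ N.σ * Kᴴ).trace)⁻¹ •
        (K * DMC.tensor N.inReg N.res ρ N.σ * Kᴴ)) := by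
  have hd := hρ.tensor N.disjoint_inReg_res h.density
  constructor
  · rintro ⟨-, ρ', c, hp, hct, rfl⟩
    obtain ⟨K', hK', rfl, rfl⟩ := hp.exists_path hd.1 hd.2.1
    obtain ⟨rfl, rfl⟩ := hC.unique h ⟨hC.input, hK', hct⟩
    exact ⟨rfl, rfl⟩
  · rintro ⟨rfl, rfl⟩
    obtain ⟨p, hp⟩ := hC.path.exists_opPath (DMC.tensor N.inReg N.res ρ N.σ)
    obtain ⟨K', hK', hKK, rfl⟩ := hp.exists_path hd.1 hd.2.1
    exact ⟨⟨hC.input, hρ⟩, _, t, hp, hC.terminal, rfl⟩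

/-- The operational semantics as the sum over the branches `o`, with total operator `K o` and final
configuration `t o`. -/
theorem WellDefined.ops_eq (h : N.WellDefined) {K : Finset Q → QOp Q}
    {t : Finset Q → A → AgentState Q X Ch}
    (hC : ∀ o ∈ N.meas.powerset, N.Completes κ o (K o) (t o)) {ρ : QOp Q}
    (hρ : IsDensity N.inReg ρ) : N.ops (κ, ρ) = ∑ o ∈ N.meas.powerset,
      weightedPoint (N.output (t o)) (K o * DMC.tensor N.inReg N.res ρ N.σ * (K o)ᴴ) := by
  refine Finset.sum_congr rfl fun o ho => ?_
  have key := fun p u => (hC o ho).opBranch_iff h hρ (p := p) (u := u)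
  have hex : ∃ pu : ℝ × PState A Q X, N.OpBranch (κ, ρ) o pu.1 pu.2 :=
    ⟨(_, _), (key _ _).2 ⟨rfl, rfl⟩⟩
  obtain ⟨h₁, h₂⟩ := (key _ _).1 hex.choose_spec
  rw [dif_pos hex, h₁, h₂]
  rfl

theorem ops_eq_zero {s : PState A Q X} (hs : ¬ N.IsInput s) : N.ops s = 0 := by
  refine Finset.sum_eq_zero fun o _ => dif_neg ?_
  rintro ⟨pt, h, -⟩
  exact hs h

/-- The operational semantics on the normalisation of a positive operator. -/
theorem WellDefined.trace_smul_ops (h : N.WellDefined) {K : Finset Q → QOp Q}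
    {t : Finset Q → A → AgentState Q X Ch}
    (hC : ∀ o ∈ N.meas.powerset, N.Completes κ o (K o) (t o)) {ρ : QOp Q}
    (hρ : ρ.PosSemidef) (hρ' : IsOpFromTo N.inReg N.inReg ρ) :
    ρ.trace.re • N.ops (κ, (ρ.trace)⁻¹ • ρ) = ∑ o ∈ N.meas.powerset,
      weightedPoint (N.output (t o)) (K o * DMC.tensor N.inReg N.res ρ N.σ * (K o)ᴴ) := by
  by_cases h0 : ρ.trace = 0
  · rw [hρ.trace_eq_zero_iff.1 h0]
    simp [tensor_zero_left, weightedPoint]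
  have hinv : (ρ.trace)⁻¹ = ((ρ.trace.re⁻¹ : ℝ) : ℂ) := by
    rw [Complex.ofReal_inv, ofReal_re_trace hρ]
  have hd : IsDensity N.inReg ((ρ.trace)⁻¹ • ρ) := by
    refine ⟨?_, ?_, hρ'.smul _⟩
    · exact hρ.smul (inv_nonneg.2 hρ.trace_nonneg)
    · rw [Matrix.trace_smul, smul_eq_mul, inv_mul_cancel₀ h0]
  have hre : ρ.trace.re ≠ 0 := fun h => h0 (by rw [← ofReal_re_trace hρ, h, Complex.ofReal_zero])
  rw [h.ops_eq hC hd, Finset.smul_sum]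
  refine Finset.sum_congr rfl fun o _ => ?_
  rw [tensor_smul_left, Matrix.mul_smul, Matrix.smul_mul, hinv, weightedPoint_smul, smul_smul,
    mul_inv_cancel₀ hre, one_smul]

end Network

/-! ### Sequential composition -/

section Simulation

variable {A Q X Ch : Type*} [DecidableEq Q]

/-- The configuration `d` has at least the memory of `c`, the additional qubits `E`, and the
programs of `c` followed by `R`. -/
def Extends (E : A → Finset Q) (R : A → List (Event Q X Ch)) (c d : A → AgentState Q X Ch) :
    Prop :=
  ∀ a, MemLe (c a).mem (d a).mem ∧ (d a).own = (c a).own ∪ E a ∧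
    (d a).prog = (c a).prog ++ R a

theorem Extends.update [DecidableEq A] {c d : A → AgentState Q X Ch} {E : A → Finset Q}
    {R : A → List (Event Q X Ch)} (h : Extends E R c d) (a : A) {x y : AgentState Q X Ch}
    (hm : MemLe x.mem y.mem) (ho : y.own = x.own ∪ E a) (hp : y.prog = x.prog ++ R a) :
    Extends E R (Function.update c a x) (Function.update d a y) := by
  intro b
  by_cases hb : b = a
  · subst hb
    simpa using ⟨hm, ho, hp⟩
  · simpa [hb] using h b

variable [DecidableEq A] [Fintype Q] [DecidableEq X] {o : Finset Q}
  {c c' d : A → AgentState Q X Ch} {K L : QOp Q} {E : A → Finset Q}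
  {R : A → List (Event Q X Ch)}

theorem Extends.step (h : Extends E R c d) (hE : ∀ a, ∀ x ∈ E a, ¬ Avail c x)
    (hs : Step o c L c') : ∃ d', Step o d L d' ∧ Extends E R c' d' := by
  cases hs with
  | pat a P es L Γ hprog hown hexec =>
    obtain ⟨hm, ho, hp⟩ := h a
    obtain ⟨Δ, hexec', hΔ⟩ := Pattern.exec_mono hexec hm
    refine ⟨_, Step.pat d a P (es ++ R a) L Δ (by simp [hp, hprog])
      (ho ▸ hown.trans Finset.subset_union_left) hexec', h.update a hΔ ?_ rfl⟩
    ext x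
    have hx : x ∈ E a → x ∉ P.I := fun hx hxI => hE a x hx ⟨a, .inl (hown hxI)⟩
    simp only [ho, Finset.mem_union, Finset.mem_sdiff]
    tauto
  | ccom a b hab ch y s v es fs ha hb hv =>
    obtain ⟨hma, hoa, hpa⟩ := h a
    obtain ⟨hmb, hob, hpb⟩ := h b
    refine ⟨_, Step.ccom d a b hab ch y s v (es ++ R a) (fs ++ R b) (by simp [hpa, ha])
      (by simp [hpb, hb]) (hmb.eval hv),
      (h.update a ?_ ?_ ?_).update b ?_ ?_ ?_⟩
    exacts [hma.update _ _, hoa, rfl, hmb, hob, rfl]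
  | qcom a b hab ch q es fs ha hb hq =>
    obtain ⟨hma, hoa, hpa⟩ := h a
    obtain ⟨hmb, hob, hpb⟩ := h b
    refine ⟨_, Step.qcom d a b hab ch q (es ++ R a) (fs ++ R b) (by simp [hpa, ha])
      (by simp [hpb, hb]) (by simp [hob, hq]),
      (h.update a ?_ ?_ ?_).update b ?_ ?_ ?_⟩
    · exact hma
    · rw [hoa, Finset.insert_union]
    · rfl
    · exact hmb
    · have hqE : q ∉ E b := fun hx => hE b q hx ⟨b, .inl hq⟩
      rw [hob, Finset.erase_union_distrib, Finset.erase_eq_of_notMem hqE]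
    · rfl

/-- A computation can be repeated with larger memories, additional qubits that it does not name,
and further events appended to the programs. -/
theorem Extends.path (h : Extends E R c d) (hE : ∀ a, ∀ x ∈ E a, ¬ Avail c x)
    (hp : Path o c K c') : ∃ d', Path o d K d' ∧ Extends E R c' d' := by
  induction hp with
  | refl => exact ⟨d, Path.refl _, h⟩
  | tail c' c'' K L hp hs ih =>
    obtain ⟨d', hd', h'⟩ := ih
    obtain ⟨d'', hd'', h''⟩ := h'.step (fun a x hx hx' => hE a x hx (hp.avail hx')) hs
    exact ⟨d'', Path.tail _ _ _ _ _ hd' hd'', h''⟩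

end Simulation

namespace Network

section Sequential

variable {A Q X Ch : Type*} [Fintype A] [DecidableEq Q] {N₁ N₂ : Network A Q X Ch}

/-- A common qubit of two composable networks is a quantum input of the second one. -/
theorem SeqComposable.mem_qin (hc : SeqComposable N₁ N₂) {x : Q} (h₁ : x ∈ N₁.names)
    (h₂ : x ∈ N₂.names) : ∃ a, x ∈ (N₂.ag a).own ∧ x ∉ N₂.res := by
  have h := hc.names_inter (Finset.mem_inter.2 ⟨h₁, h₂⟩)
  simp only [outReg, Finset.mem_biUnion, Finset.mem_univ, true_and] at h
  obtain ⟨a, ha⟩ := h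
  rw [hc.quantum a] at ha
  exact ⟨a, Finset.mem_sdiff.1 ha⟩

theorem SeqComposable.inReg_eq (hc : SeqComposable N₁ N₂) : N₂.inReg = N₁.outReg := by
  unfold inReg outReg
  exact Finset.biUnion_congr rfl fun a _ => (hc.quantum a).symm

theorem comp_meas (N₁ N₂ : Network A Q X Ch) : (N₂.comp N₁).meas = N₁.meas ∪ N₂.meas := by
  ext x
  simp only [meas, comp, gather_append, Finset.mem_biUnion, Finset.mem_univ, true_and,
    Finset.mem_union, exists_or]

variable [DecidableEq A] [Fintype Q] [DecidableEq X] {κ : A → Mem Q X} {o : Finset Q}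
  {K₁ K₂ : QOp Q}
  {t₁ t₂ : A → AgentState Q X Ch}

theorem SeqComposable.disjoint_names_res (hc : SeqComposable N₁ N₂) (h₂ : N₂.WellDefined) :
    Disjoint N₁.names N₂.res := by
  rw [Finset.disjoint_left]
  intro x hx₁ hx₂
  obtain ⟨a, -, h⟩ := hc.mem_qin hx₁ (h₂.static.res_subset_names hx₂)
  exact h hx₂

theorem SeqComposable.disjoint_names_prepared (hc : SeqComposable N₁ N₂) (h₂ : N₂.WellDefined)
    (a : A) : Disjoint N₁.names (gather Event.prepared (N₂.ag a).prog) := by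
  rw [Finset.disjoint_left]
  intro x hx₁ hx₂
  obtain ⟨b, h, -⟩ := hc.mem_qin hx₁ (mem_names.2 ⟨a, .inr (gather_prepared_subset_space hx₂)⟩)
  exact Finset.disjoint_left.1 (h₂.prepared_new a b) hx₂ h

theorem SeqComposable.disjoint_meas (hc : SeqComposable N₁ N₂) (h₁ : N₁.WellDefined) :
    Disjoint N₁.meas N₂.meas := by
  rw [Finset.disjoint_left]
  intro x hx₁ hx₂
  exact Finset.disjoint_left.1 h₁.disjoint_meas_outReg hx₁ (hc.names_inter
    (Finset.mem_inter.2 ⟨N₁.meas_subset_names hx₁, N₂.meas_subset_names hx₂⟩))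

theorem SeqComposable.static (hc : SeqComposable N₁ N₂) (h₁ : N₁.WellDefined)
    (h₂ : N₂.WellDefined) : (N₂.comp N₁).Static where
  res_subset q hq := by
    rcases Finset.mem_union.1 hq with hq | hq
    · obtain ⟨a, ha⟩ := h₁.res_subset q hq
      exact ⟨a, Finset.mem_union_left _ ha⟩
    · obtain ⟨a, ha⟩ := h₂.res_subset q hq
      exact ⟨a, Finset.mem_union_right _ (Finset.mem_inter.2 ⟨ha, hq⟩)⟩
  density := h₁.density.tensor
    ((hc.disjoint_names_res h₂).mono_left h₁.static.res_subset_names) h₂.density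
  own_disjoint a b hab := by
    have h := hc.disjoint_names_res h₂
    simp only [comp, Finset.disjoint_union_left, Finset.disjoint_union_right]
    exact ⟨⟨h₁.own_disjoint a b hab,
        (h.mono (N₁.own_subset_names b) Finset.inter_subset_right).symm⟩,
      h.mono (N₁.own_subset_names a) Finset.inter_subset_right,
      (h₂.own_disjoint a b hab).mono Finset.inter_subset_left Finset.inter_subset_left⟩
  prepared_new a b := by
    simp only [comp, gather_append, Finset.disjoint_union_left, Finset.disjoint_union_right]
    exact ⟨⟨h₁.prepared_new a b,
        ((hc.disjoint_names_prepared h₂ a).mono_left (N₁.own_subset_names b)).symm⟩,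
      (hc.disjoint_names_res h₂).mono (N₁.prepared_subset_names a) Finset.inter_subset_right,
      (h₂.prepared_new a b).mono_right Finset.inter_subset_left⟩
  prepared_agents a b hab := by
    simp only [comp, gather_append, Finset.disjoint_union_left, Finset.disjoint_union_right]
    exact ⟨⟨h₁.prepared_agents a b hab,
        ((hc.disjoint_names_prepared h₂ a).mono_left (N₁.prepared_subset_names b)).symm⟩,
      (hc.disjoint_names_prepared h₂ b).mono_left (N₁.prepared_subset_names a),
      h₂.prepared_agents a b hab⟩
  prepared_once a := by
    refine List.pairwise_append.2 ⟨h₁.prepared_once a, h₂.prepared_once a, fun e he f hf => ?_⟩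
    refine (hc.disjoint_names_prepared h₂ a).mono (fun x hx => ?_)
      fun x hx => mem_gather.2 ⟨f, hf, hx⟩
    exact N₁.prepared_subset_names a (mem_gather.2 ⟨e, he, hx⟩)
  channels ch := by
    have : {a | (N₂.comp N₁).Uses a ch} = {a | N₁.Uses a ch ∨ N₂.Uses a ch} := by
      ext a
      simp only [Uses, comp, List.mem_append, or_and_right, exists_or, Set.mem_ofPred_eq]
    rw [this]
    exact hc.channels ch

theorem SeqComposable.classicalInput_output (hc : SeqComposable N₁ N₂) (h₁ : N₁.WellDefined)
    (hC : N₁.Completes κ o K₁ t₁) : N₂.ClassicalInput (N₁.output t₁) := fun a r => by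
  rw [hC.isSome_output h₁]
  exact Finset.ext_iff.1 (hc.classical a) r

/-- A branch of the composite network: all agents execute the first network, then the second one. -/
theorem SeqComposable.exists_completes (hc : SeqComposable N₁ N₂) (h₂ : N₂.WellDefined)
    (hC₁ : N₁.Completes κ o K₁ t₁) (hC₂ : N₂.Completes (N₁.output t₁) o K₂ t₂) :
    ∃ t, (N₂.comp N₁).Completes κ o (K₂ * K₁) t ∧
      (∀ a, MemLe (t₂ a).mem (t a).mem) ∧ ∀ a, (t a).own = (t₂ a).own := by
  have hE : Extends (fun a => (N₂.ag a).own ∩ N₂.res) (fun a => (N₂.ag a).prog)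
      (N₁.init κ) ((N₂.comp N₁).init κ) := fun a => ⟨MemLe.refl _, rfl, rfl⟩
  obtain ⟨d, hd, hd'⟩ := hE.path (fun a x hx hx' => Finset.disjoint_left.1
    (hc.disjoint_names_res h₂) (mem_names_of_avail hx') (Finset.mem_inter.1 hx).2) hC₁.path
  -- At the end of `N₁` every agent owns exactly its qubits of `N₂`, and its memory contains its
  -- classical inputs in `N₂`, but possibly also other values.
  have hE₂ : Extends (fun _ => ∅) (fun _ => []) (N₂.init (N₁.output t₁)) d := by
    intro a
    obtain ⟨hm, ho, hp⟩ := hd' a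
    refine ⟨fun r v hr => ?_, ?_, ?_⟩
    · simp only [init, output] at hr
      split_ifs at hr
      exact hm r v hr
    · rw [ho, hC₁.own_eq, hc.quantum a, Finset.union_empty]
      exact Finset.sdiff_union_inter _ _
    · rw [hp, hC₁.terminal a, List.append_nil, List.nil_append]
      rfl
  obtain ⟨t, ht, ht'⟩ := hE₂.path (by simp) hC₂.path
  refine ⟨t, ⟨hC₁.input, hd.trans ht, fun a => ?_⟩, fun a => (ht' a).1, fun a => ?_⟩
  · rw [(ht' a).2.2, hC₂.terminal a, List.append_nil]
  · rw [(ht' a).2.1, Finset.union_empty]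

/-- The outputs of the second network have values in its own computation, hence the same values in a
larger memory. -/
theorem output_eq_of_memLe {t : A → AgentState Q X Ch} (hC : N₂.Completes κ o K₂ t₂)
    (h₂ : N₂.WellDefined) (hm : ∀ a, MemLe (t₂ a).mem (t a).mem) :
    (N₂.comp N₁).output t = N₂.output t₂ := by
  funext a r
  unfold output
  by_cases hr : r ∈ (N₂.ag a).cout
  · obtain ⟨v, hv⟩ := Option.isSome_iff_exists.1 (hC.isSome_mem h₂ hr)
    rw [if_pos hr, if_pos (show r ∈ ((N₂.comp N₁).ag a).cout from hr), hv, hm a r v hv]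
  · rw [if_neg hr, if_neg (show r ∉ ((N₂.comp N₁).ag a).cout from hr)]

theorem SeqComposable.wellDefined (hc : SeqComposable N₁ N₂) (h₁ : N₁.WellDefined)
    (h₂ : N₂.WellDefined) : (N₂.comp N₁).WellDefined := by
  refine (hc.static h₁ h₂).wellDefined fun κ hκ o => ?_
  obtain ⟨K₁, t₁, hC₁⟩ := h₁.exists_completes (κ := κ) hκ o
  obtain ⟨K₂, t₂, hC₂⟩ := h₂.exists_completes (hc.classicalInput_output h₁ hC₁) o
  obtain ⟨t, hC, hm, -⟩ := hc.exists_completes h₂ hC₁ hC₂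
  refine ⟨_, t, hC, fun a r hr => ?_⟩
  obtain ⟨v, hv⟩ := Option.isSome_iff_exists.1 (hC₂.isSome_mem h₂ (a := a) hr)
  rw [hm a r v hv]
  rfl

theorem SeqComposable.sig_eq (hc : SeqComposable N₁ N₂) (h₁ : N₁.WellDefined)
    (h₂ : N₂.WellDefined) : (N₂.comp N₁).sig = N₂.sig.comp N₁.sig := by
  obtain ⟨κ, hκ⟩ := N₁.exists_classicalInput
  obtain ⟨K₁, t₁, hC₁⟩ := h₁.exists_completes hκ ∅
  obtain ⟨K₂, t₂, hC₂⟩ := h₂.exists_completes (hc.classicalInput_output h₁ hC₁) ∅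
  obtain ⟨t, hC, -, ho⟩ := hc.exists_completes h₂ hC₁ hC₂
  refine TypeSig.ext ?_ ?_ rfl rfl
  · funext a
    ext x
    have hx : x ∈ (N₁.ag a).own → x ∉ N₂.res := fun h =>
      Finset.disjoint_left.1 (hc.disjoint_names_res h₂) (N₁.own_subset_names a h)
    simp only [sig, comp, TypeSig.comp, Finset.mem_sdiff, Finset.mem_union, Finset.mem_inter]
    tauto
  · funext a
    rw [← hC.own_eq, ho, hC₂.own_eq]
    rfl

theorem SeqComposable.comp_inReg (hc : SeqComposable N₁ N₂) (h₁ : N₁.WellDefined)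
    (h₂ : N₂.WellDefined) : (N₂.comp N₁).inReg = N₁.inReg := by
  rw [inReg, hc.sig_eq h₁ h₂]
  rfl

theorem SeqComposable.comp_outReg (hc : SeqComposable N₁ N₂) (h₁ : N₁.WellDefined)
    (h₂ : N₂.WellDefined) : (N₂.comp N₁).outReg = N₂.outReg := by
  rw [outReg, hc.sig_eq h₁ h₂]
  rfl

/-- The branches of the composite network with their operators and classical outputs: for every
choice of the outcomes of the first network a branch of the second one, which starts from the
classical outputs of the first. -/
theorem SeqComposable.exists_branches (hc : SeqComposable N₁ N₂) (h₁ : N₁.WellDefined)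
    (h₂ : N₂.WellDefined) (hκ : N₁.ClassicalInput κ) :
    ∃ (K₁ : Finset Q → QOp Q) (t₁ : Finset Q → A → AgentState Q X Ch)
      (K₂ : Finset Q → Finset Q → QOp Q) (t₂ : Finset Q → Finset Q → A → AgentState Q X Ch),
      (∀ o₁, N₁.Completes κ o₁ (K₁ o₁) (t₁ o₁)) ∧
      (∀ o₁ o₂, N₂.Completes (N₁.output (t₁ o₁)) o₂ (K₂ o₁ o₂) (t₂ o₁ o₂)) ∧
      ∀ o₁ ∈ N₁.meas.powerset, ∀ o₂ ∈ N₂.meas.powerset, ∃ t,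
        (N₂.comp N₁).Completes κ (o₁ ∪ o₂) (K₂ o₁ o₂ * K₁ o₁) t ∧
        (N₂.comp N₁).output t = N₂.output (t₂ o₁ o₂) := by
  choose K₁ t₁ hC₁ using fun o => h₁.exists_completes hκ o
  choose K₂ t₂ hC₂ using fun o₁ o₂ =>
    h₂.exists_completes (hc.classicalInput_output h₁ (hC₁ o₁)) o₂
  refine ⟨K₁, t₁, K₂, t₂, hC₁, hC₂, fun o₁ ho₁ o₂ ho₂ => ?_⟩
  rw [Finset.mem_powerset] at ho₁ ho₂
  have hd := Finset.disjoint_left.1 (hc.disjoint_meas h₁)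
  have e₁ : N₁.Completes κ (o₁ ∪ o₂) (K₁ o₁) (t₁ o₁) := (hC₁ o₁).congr_outcomes fun x hx => by
    rw [Finset.mem_union]
    exact ⟨.inl, fun h => h.resolve_right fun h => hd hx (ho₂ h)⟩
  have e₂ : N₂.Completes (N₁.output (t₁ o₁)) (o₁ ∪ o₂) (K₂ o₁ o₂) (t₂ o₁ o₂) :=
    (hC₂ o₁ o₂).congr_outcomes fun x hx => by
      rw [Finset.mem_union]
      exact ⟨.inr, fun h => h.resolve_left fun h => hd (ho₁ h) hx⟩
  obtain ⟨t, hC, hm, -⟩ := hc.exists_completes h₂ e₁ e₂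
  exact ⟨t, hC, output_eq_of_memLe e₂ h₂ hm⟩

/-- The operator of the first network leaves the resource of the second one alone. -/
theorem SeqComposable.conj_comp (hc : SeqComposable N₁ N₂) (h₁ : N₁.WellDefined)
    (h₂ : N₂.WellDefined) (hC₁ : N₁.Completes κ o K₁ t₁) (K₂ ρ : QOp Q) :
    K₂ * K₁ * DMC.tensor (N₂.comp N₁).inReg (N₂.comp N₁).res ρ (N₂.comp N₁).σ * (K₂ * K₁)ᴴ =
      K₂ * DMC.tensor N₂.inReg N₂.res (K₁ * DMC.tensor N₁.inReg N₁.res ρ N₁.σ * K₁ᴴ) N₂.σ *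
        K₂ᴴ := by
  have h := hC₁.localOn.conj_tensor_left (hc.disjoint_names_res h₂)
    (Finset.union_subset N₁.inReg_subset_names h₁.static.res_subset_names)
    h₁.outReg_subset_names (hC₁.carries h₁)
    (isOpFromTo_tensor N₁.inReg N₁.res ρ N₁.σ) N₂.σ
  rw [← tensor_assoc] at h
  rw [hc.comp_inReg h₁ h₂, hc.inReg_eq, ← h, Matrix.conjTranspose_mul]
  simp only [comp, Matrix.mul_assoc]

theorem SeqComposable.den_eq [Fintype X] (hc : SeqComposable N₁ N₂) (h₁ : N₁.WellDefined)
    (h₂ : N₂.WellDefined) (κ κ'' : A → Mem Q X) :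
    (N₂.comp N₁).den κ κ'' = ∑ κ', N₂.den κ' κ'' ∘ₗ N₁.den κ κ' := by
  by_cases hκ : N₁.ClassicalInput κ
  swap
  · rw [den_eq_zero (N := N₂.comp N₁) hκ]
    simp [den_eq_zero hκ]
  obtain ⟨K₁, t₁, K₂, t₂, hC₁, hC₂, hC⟩ := hc.exists_branches h₁ h₂ hκ
  refine LinearMap.ext fun ρ => ?_
  -- A branch of `N₁` contributes to one term only, that of its classical output.
  have hsum : ∀ κ', (N₂.den κ' κ'' ∘ₗ N₁.den κ κ') ρ = ∑ o₁ ∈ N₁.meas.powerset,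
      if κ' = N₁.output (t₁ o₁) then N₂.den (N₁.output (t₁ o₁)) κ''
        (K₁ o₁ * DMC.tensor N₁.inReg N₁.res ρ N₁.σ * (K₁ o₁)ᴴ) else 0 := by
    intro κ'
    rw [LinearMap.comp_apply, den_apply (N := N₁), map_sum]
    refine Finset.sum_congr rfl fun o₁ _ => ?_
    rw [(hC₁ o₁).branchOp_eq h₁]
    split_ifs with h
    · rw [h]
    · simp
  rw [LinearMap.sum_apply, Finset.sum_congr rfl fun κ' _ => hsum κ', Finset.sum_comm,
    den_apply, comp_meas, sum_powerset_union (hc.disjoint_meas h₁)]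
  refine Finset.sum_congr rfl fun o₁ ho₁ => ?_
  rw [Finset.sum_ite_eq' Finset.univ, if_pos (Finset.mem_univ _), den_apply]
  refine Finset.sum_congr rfl fun o₂ ho₂ => ?_
  obtain ⟨t, ht, hout⟩ := hC o₁ ho₁ o₂ ho₂
  rw [ht.branchOp_eq (hc.wellDefined h₁ h₂), (hC₂ o₁ o₂).branchOp_eq h₂, hout]
  split_ifs
  · exact hc.conj_comp h₁ h₂ (hC₁ o₁) _ _
  · simp

theorem SeqComposable.ops_eq (hc : SeqComposable N₁ N₂) (h₁ : N₁.WellDefined)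
    (h₂ : N₂.WellDefined) : (N₂.comp N₁).ops = ptsComp N₂.ops N₁.ops := by
  funext s
  obtain ⟨κ, ρ⟩ := s
  rw [ptsComp_apply]
  by_cases hs : N₁.IsInput (κ, ρ)
  swap
  · rw [ops_eq_zero hs, map_zero]
    refine ops_eq_zero fun h => hs ⟨h.1, ?_⟩
    rw [← hc.comp_inReg h₁ h₂]
    exact h.2
  obtain ⟨hκ, hρ⟩ := hs
  have hd := hρ.tensor N₁.disjoint_inReg_res h₁.density
  obtain ⟨K₁, t₁, K₂, t₂, hC₁, hC₂, hC⟩ := hc.exists_branches h₁ h₂ hκ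
  have h := hc.wellDefined h₁ h₂
  choose K t ht using fun o => h.exists_completes (κ := κ) hκ o
  rw [h.ops_eq (fun o _ => ht o) (by rw [hc.comp_inReg h₁ h₂]; exact hρ),
    h₁.ops_eq (fun o _ => hC₁ o) hρ, map_sum, comp_meas,
    sum_powerset_union (hc.disjoint_meas h₁)]
  refine Finset.sum_congr rfl fun o₁ ho₁ => ?_
  rw [weightedPoint, Finsupp.linearCombination_single, h₂.trace_smul_ops (fun o _ => hC₂ o₁ o)
    (hd.1.mul_mul_conjTranspose_same _)
    (hc.inReg_eq ▸ ((hC₁ o₁).carries h₁).conj_isOpFromTo hd.2.2)]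
  refine Finset.sum_congr rfl fun o₂ ho₂ => ?_
  obtain ⟨t', ht', hout⟩ := hC o₁ ho₁ o₂ ho₂
  obtain ⟨et, eK⟩ := ht'.unique h (ht (o₁ ∪ o₂))
  rw [et, eK, hout, hc.conj_comp h₁ h₂ (hC₁ o₁)]

end Sequential

end Network

/-! ### Parallel composition -/

section MapTensor

variable {Q : Type*} [DecidableEq Q]

theorem tensor_single_single {S T : Finset Q} {b₁ c₁ b₂ c₂ : Finset Q} (h : Disjoint S T)
    (hb₁ : b₁ ⊆ S) (hc₁ : c₁ ⊆ S) (hb₂ : b₂ ⊆ T) (hc₂ : c₂ ⊆ T) :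
    tensor S T (Matrix.single b₁ c₁ 1) (Matrix.single b₂ c₂ 1) =
      Matrix.single (b₁ ∪ b₂) (c₁ ∪ c₂) 1 := by
  rw [Finset.disjoint_left] at h
  have key : ∀ {d₁ d₂ b : Finset Q}, d₁ ⊆ S → d₂ ⊆ T →
      (d₁ ∪ d₂ = b ↔ b ⊆ S ∪ T ∧ d₁ = b ∩ S ∧ d₂ = b ∩ T) := by
    intro d₁ d₂ b h₁ h₂
    constructor
    · rintro rfl
      exact ⟨Finset.union_subset_union h₁ h₂, by grind, by grind⟩
    · rintro ⟨hb, rfl, rfl⟩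
      rw [← Finset.inter_union_distrib_left, Finset.inter_eq_left.2 hb]
  ext b c
  simp only [tensor, Matrix.of_apply, Matrix.single_apply, key hb₁ hb₂, key hc₁ hc₂]
  by_cases hb : b ⊆ S ∪ T <;> by_cases hc : c ⊆ S ∪ T <;>
    by_cases e₁ : b₁ = b ∩ S <;> by_cases e₂ : c₁ = c ∩ S <;> simp [hb, hc, e₁, e₂]

theorem tensor_congr_left {S T : Finset Q} {ρ ρ' : QOp Q} (h : ∀ b ⊆ S, ∀ c ⊆ S, ρ b c = ρ' b c)
    (σ : QOp Q) : tensor S T ρ σ = tensor S T ρ' σ := by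
  ext b c
  simp only [tensor, Matrix.of_apply,
    h (b ∩ S) Finset.inter_subset_right (c ∩ S) Finset.inter_subset_right]

/-- The restriction of an operator to a composite register in terms of product operators. -/
theorem sum_smul_tensor_single {S T : Finset Q} (h : Disjoint S T) (ρ : QOp Q) {b c : Finset Q}
    (hb : b ⊆ S ∪ T) (hc : c ⊆ S ∪ T) :
    (∑ b₁ ∈ S.powerset, ∑ c₁ ∈ S.powerset, ∑ b₂ ∈ T.powerset, ∑ c₂ ∈ T.powerset,
      ρ (b₁ ∪ b₂) (c₁ ∪ c₂) •
        tensor S T (Matrix.single b₁ c₁ 1) (Matrix.single b₂ c₂ 1)) b c = ρ b c := by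
  have hsum : (∑ b₁ ∈ S.powerset, ∑ c₁ ∈ S.powerset, ∑ b₂ ∈ T.powerset, ∑ c₂ ∈ T.powerset,
      ρ (b₁ ∪ b₂) (c₁ ∪ c₂) • tensor S T (Matrix.single b₁ c₁ 1) (Matrix.single b₂ c₂ 1)) =
      ∑ b ∈ (S ∪ T).powerset, ∑ c ∈ (S ∪ T).powerset, ρ b c • Matrix.single b c 1 := by
    rw [sum_powerset_union h]
    refine Finset.sum_congr rfl fun b₁ hb₁ => ?_
    rw [Finset.sum_comm]
    refine Finset.sum_congr rfl fun b₂ hb₂ => ?_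
    rw [sum_powerset_union h]
    refine Finset.sum_congr rfl fun c₁ hc₁ => Finset.sum_congr rfl fun c₂ hc₂ => ?_
    rw [Finset.mem_powerset] at hb₁ hb₂ hc₁ hc₂
    rw [tensor_single_single h hb₁ hc₁ hb₂ hc₂]
  rw [hsum, Matrix.sum_apply, Finset.sum_eq_single b, Matrix.sum_apply, Finset.sum_eq_single c]
  · simp
  · intro c' _ hne
    simp [hne]
  · exact fun hn => absurd (Finset.mem_powerset.2 hc) hn
  · intro b' _ hne
    rw [Matrix.sum_apply]
    exact Finset.sum_eq_zero fun c' _ => by simp [hne]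
  · exact fun hn => absurd (Finset.mem_powerset.2 hb) hn

end MapTensor

section DistTensor

variable {A₁ A₂ Q X : Type*} [DecidableEq Q]

theorem distTensor_apply (T₁ T₂ : Finset Q) (D₁ : PState A₁ Q X →₀ ℝ)
    (D₂ : PState A₂ Q X →₀ ℝ) : distTensor T₁ T₂ D₁ D₂ =
      Finsupp.linearCombination ℝ (fun t₁ => Finsupp.linearCombination ℝ
        (fun t₂ => Finsupp.single (stateTensor T₁ T₂ t₁ t₂) (1 : ℝ)) D₂) D₁ := by
  simp only [distTensor, Finsupp.linearCombination_apply, Finsupp.smul_sum, Finsupp.smul_single,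
    smul_eq_mul, mul_one]

theorem distTensor_sum {ι₁ ι₂ : Type*} (T₁ T₂ : Finset Q) (s₁ : Finset ι₁) (s₂ : Finset ι₂)
    (D₁ : ι₁ → PState A₁ Q X →₀ ℝ) (D₂ : ι₂ → PState A₂ Q X →₀ ℝ) :
    distTensor T₁ T₂ (∑ i ∈ s₁, D₁ i) (∑ j ∈ s₂, D₂ j) =
      ∑ i ∈ s₁, ∑ j ∈ s₂, distTensor T₁ T₂ (D₁ i) (D₂ j) := by
  simp only [distTensor_apply, map_sum]
  refine Finset.sum_congr rfl fun i _ => ?_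
  simp only [Finsupp.linearCombination_apply, Finsupp.smul_sum, Finset.smul_sum]
  simp only [Finsupp.sum]
  rw [Finset.sum_comm]

theorem distTensor_weightedPoint [Fintype Q] {T₁ T₂ : Finset Q} (h : Disjoint T₁ T₂)
    (κ₁ : A₁ → Mem Q X) (κ₂ : A₂ → Mem Q X) {ρ₁ ρ₂ : QOp Q} (h₁ : ρ₁.PosSemidef)
    (h₂ : ρ₂.PosSemidef)
    (hρ₁ : IsOpFromTo T₁ T₁ ρ₁) (hρ₂ : IsOpFromTo T₂ T₂ ρ₂) :
    distTensor T₁ T₂ (weightedPoint κ₁ ρ₁) (weightedPoint κ₂ ρ₂) =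
      weightedPoint (Sum.elim κ₁ κ₂) (tensor T₁ T₂ ρ₁ ρ₂) := by
  have hre : (ρ₁.trace * ρ₂.trace).re = ρ₁.trace.re * ρ₂.trace.re := by
    rw [← ofReal_re_trace h₁, ← ofReal_re_trace h₂, ← Complex.ofReal_mul]
    simp
  simp only [distTensor, weightedPoint]
  rw [Finsupp.sum_single_index (by simp), Finsupp.sum_single_index (by simp),
    trace_tensor h hρ₁ hρ₂, hre]
  simp only [stateTensor, tensor_smul_left, tensor_smul_right, smul_smul, mul_inv, mul_comm]

end DistTensor

section Juxtaposition

variable {A₁ A₂ Q X Ch : Type*} [DecidableEq A₁] [DecidableEq A₂] [Fintype Q] [DecidableEq Q]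
  [DecidableEq X] {o : Finset Q} {K : QOp Q}

theorem Step.inl {c c' : A₁ → AgentState Q X Ch} (h : Step o c K c')
    (d : A₂ → AgentState Q X Ch) : Step o (Sum.elim c d) K (Sum.elim c' d) := by
  cases h with
  | pat a P es L Γ hprog hown hexec =>
    rw [← Sum.update_elim_inl]
    exact Step.pat _ (Sum.inl a) P es _ Γ hprog hown hexec
  | ccom a b hab ch y s v es fs ha hb hv =>
    rw [← Sum.update_elim_inl, ← Sum.update_elim_inl]
    exact Step.ccom (Sum.elim c d) (Sum.inl a) (Sum.inl b) (by simpa using hab) ch y s v es fs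
      ha hb hv
  | qcom a b hab ch q es fs ha hb hq =>
    rw [← Sum.update_elim_inl, ← Sum.update_elim_inl]
    exact Step.qcom (Sum.elim c d) (Sum.inl a) (Sum.inl b) (by simpa using hab) ch q es fs
      ha hb hq

theorem Step.inr {d d' : A₂ → AgentState Q X Ch} (h : Step o d K d')
    (c : A₁ → AgentState Q X Ch) : Step o (Sum.elim c d) K (Sum.elim c d') := by
  cases h with
  | pat a P es L Γ hprog hown hexec =>
    rw [← Sum.update_elim_inr]
    exact Step.pat _ (Sum.inr a) P es _ Γ hprog hown hexec
  | ccom a b hab ch y s v es fs ha hb hv =>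
    rw [← Sum.update_elim_inr, ← Sum.update_elim_inr]
    exact Step.ccom (Sum.elim c d) (Sum.inr a) (Sum.inr b) (by simpa using hab) ch y s v es fs
      ha hb hv
  | qcom a b hab ch q es fs ha hb hq =>
    rw [← Sum.update_elim_inr, ← Sum.update_elim_inr]
    exact Step.qcom (Sum.elim c d) (Sum.inr a) (Sum.inr b) (by simpa using hab) ch q es fs
      ha hb hq

theorem Path.inl {c c' : A₁ → AgentState Q X Ch} (h : Path o c K c')
    (d : A₂ → AgentState Q X Ch) : Path o (Sum.elim c d) K (Sum.elim c' d) := by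
  induction h with
  | refl => exact Path.refl _
  | tail c' c'' K L hp hs ih => exact Path.tail _ _ _ _ _ ih (hs.inl d)

theorem Path.inr {d d' : A₂ → AgentState Q X Ch} (h : Path o d K d')
    (c : A₁ → AgentState Q X Ch) : Path o (Sum.elim c d) K (Sum.elim c d') := by
  induction h with
  | refl => exact Path.refl _
  | tail c' c'' K L hp hs ih => exact Path.tail _ _ _ _ _ ih (hs.inr c)

end Juxtaposition

namespace Network

section Parallel

variable {A₁ A₂ Q X Ch : Type*} [DecidableEq Q] {N₁ : Network A₁ Q X Ch}
  {N₂ : Network A₂ Q X Ch}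

theorem classicalInput_tensor_iff {κ : A₁ ⊕ A₂ → Mem Q X} : (N₁.tensor N₂).ClassicalInput κ ↔
    N₁.ClassicalInput (κ ∘ Sum.inl) ∧ N₂.ClassicalInput (κ ∘ Sum.inr) :=
  Sum.forall

theorem init_tensor (κ : A₁ ⊕ A₂ → Mem Q X) : (N₁.tensor N₂).init κ =
    Sum.elim (N₁.init (κ ∘ Sum.inl)) (N₂.init (κ ∘ Sum.inr)) := by
  funext a
  rcases a with a | a <;> rfl

theorem output_tensor [DecidableEq X] {t₁ : A₁ → AgentState Q X Ch}
    {t₂ : A₂ → AgentState Q X Ch} : (N₁.tensor N₂).output (Sum.elim t₁ t₂) =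
      Sum.elim (N₁.output t₁) (N₂.output t₂) := by
  funext a
  rcases a with a | a <;> rfl

theorem Completes.tensor [DecidableEq A₁] [DecidableEq A₂] [Fintype Q] [DecidableEq X]
    {o : Finset Q} {K₁ K₂ : QOp Q} {t₁ : A₁ → AgentState Q X Ch} {t₂ : A₂ → AgentState Q X Ch}
    {κ : A₁ ⊕ A₂ → Mem Q X}
    (hC₁ : N₁.Completes (κ ∘ Sum.inl) o K₁ t₁) (hC₂ : N₂.Completes (κ ∘ Sum.inr) o K₂ t₂) :
    (N₁.tensor N₂).Completes κ o (K₂ * K₁) (Sum.elim t₁ t₂) where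
  input := classicalInput_tensor_iff.2 ⟨hC₁.input, hC₂.input⟩
  path := by
    rw [init_tensor]
    exact (hC₁.path.inl _).trans (hC₂.path.inr _)
  terminal := Sum.forall.2 ⟨hC₁.terminal, hC₂.terminal⟩

variable [Fintype A₁] [Fintype A₂]

theorem ParComposable.disjoint_meas (hc : ParComposable N₁ N₂) : Disjoint N₁.meas N₂.meas :=
  hc.names_disjoint.mono N₁.meas_subset_names N₂.meas_subset_names

theorem tensor_meas (N₁ : Network A₁ Q X Ch) (N₂ : Network A₂ Q X Ch) :
    (N₁.tensor N₂).meas = N₁.meas ∪ N₂.meas := by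
  ext x
  simp [meas, tensor]

theorem tensor_outReg (N₁ : Network A₁ Q X Ch) (N₂ : Network A₂ Q X Ch) :
    (N₁.tensor N₂).outReg = N₁.outReg ∪ N₂.outReg := by
  ext x
  simp [outReg, sig, tensor]

variable [DecidableEq A₁] [DecidableEq A₂] [Fintype Q] [DecidableEq X]
  {κ₁ : A₁ → Mem Q X} {κ₂ : A₂ → Mem Q X} {o : Finset Q} {K₁ K₂ : QOp Q}
  {t₁ : A₁ → AgentState Q X Ch} {t₂ : A₂ → AgentState Q X Ch}

theorem ParComposable.sig_eq (hc : ParComposable N₁ N₂) (h₁ : N₁.WellDefined)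
    (h₂ : N₂.WellDefined) : (N₁.tensor N₂).sig = N₁.sig.tensor N₂.sig := by
  have hd := Finset.disjoint_left.1 hc.names_disjoint
  refine TypeSig.ext ?_ ?_ ?_ ?_
  · funext a
    ext x
    rcases a with a | a
    · have hx : x ∈ (N₁.ag a).own → x ∉ N₂.res := fun h h' =>
        hd (N₁.own_subset_names a h) (h₂.static.res_subset_names h')
      simp only [sig, tensor, TypeSig.tensor, Sum.elim_inl, Finset.mem_sdiff, Finset.mem_union]
      tauto
    · have hx : x ∈ (N₂.ag a).own → x ∉ N₁.res := fun h h' =>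
        hd (h₁.static.res_subset_names h') (N₂.own_subset_names a h)
      simp only [sig, tensor, TypeSig.tensor, Sum.elim_inr, Finset.mem_sdiff, Finset.mem_union]
      tauto
  all_goals
    funext a
    rcases a with a | a <;> rfl

theorem ParComposable.tensor_inReg (hc : ParComposable N₁ N₂) (h₁ : N₁.WellDefined)
    (h₂ : N₂.WellDefined) : (N₁.tensor N₂).inReg = N₁.inReg ∪ N₂.inReg := by
  rw [inReg, hc.sig_eq h₁ h₂]
  ext x
  simp [inReg, TypeSig.tensor]

theorem ParComposable.static (hc : ParComposable N₁ N₂) (h₁ : N₁.WellDefined)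
    (h₂ : N₂.WellDefined) : (N₁.tensor N₂).Static where
  res_subset q hq := by
    rcases Finset.mem_union.1 hq with hq | hq
    · obtain ⟨a, ha⟩ := h₁.res_subset q hq
      exact ⟨Sum.inl a, ha⟩
    · obtain ⟨a, ha⟩ := h₂.res_subset q hq
      exact ⟨Sum.inr a, ha⟩
  density := h₁.density.tensor
    (hc.names_disjoint.mono h₁.static.res_subset_names h₂.static.res_subset_names) h₂.density
  own_disjoint a b hab := by
    rcases a with a | a <;> rcases b with b | b
    · exact h₁.own_disjoint a b fun h => hab (h ▸ rfl)
    · exact hc.names_disjoint.mono (N₁.own_subset_names a) (N₂.own_subset_names b)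
    · exact hc.names_disjoint.symm.mono (N₂.own_subset_names a) (N₁.own_subset_names b)
    · exact h₂.own_disjoint a b fun h => hab (h ▸ rfl)
  prepared_new a b := by
    rcases a with a | a <;> rcases b with b | b
    · exact h₁.prepared_new a b
    · exact hc.names_disjoint.mono (N₁.prepared_subset_names a) (N₂.own_subset_names b)
    · exact hc.names_disjoint.symm.mono (N₂.prepared_subset_names a) (N₁.own_subset_names b)
    · exact h₂.prepared_new a b
  prepared_agents a b hab := by
    rcases a with a | a <;> rcases b with b | b
    · exact h₁.prepared_agents a b fun h => hab (h ▸ rfl)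
    · exact hc.names_disjoint.mono (N₁.prepared_subset_names a) (N₂.prepared_subset_names b)
    · exact hc.names_disjoint.symm.mono (N₂.prepared_subset_names a) (N₁.prepared_subset_names b)
    · exact h₂.prepared_agents a b fun h => hab (h ▸ rfl)
  prepared_once a := by
    rcases a with a | a
    · exact h₁.prepared_once a
    · exact h₂.prepared_once a
  channels ch := by
    -- A channel is used in one of the networks only.
    by_cases h : ∃ a, N₁.Uses a ch
    · obtain ⟨a₁, ha₁⟩ := h
      have hs : {a | (N₁.tensor N₂).Uses a ch} = Sum.inl '' {a | N₁.Uses a ch} := by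
        ext a
        rcases a with a | a
        · simp [Uses, tensor]
        · simpa [Uses, tensor] using fun e he hech => hc.channels ch a₁ a ⟨ha₁, e, he, hech⟩
      rw [hs, Set.ncard_image_of_injective _ Sum.inl_injective]
      exact h₁.channels ch
    · have hs : {a | (N₁.tensor N₂).Uses a ch} = Sum.inr '' {a | N₂.Uses a ch} := by
        ext a
        rcases a with a | a
        · simpa [Uses, tensor] using fun e he hech => h ⟨a, e, he, hech⟩
        · simp [Uses, tensor]
      rw [hs, Set.ncard_image_of_injective _ Sum.inr_injective]
      exact h₂.channels ch

theorem ParComposable.wellDefined (hc : ParComposable N₁ N₂) (h₁ : N₁.WellDefined)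
    (h₂ : N₂.WellDefined) : (N₁.tensor N₂).WellDefined := by
  refine (hc.static h₁ h₂).wellDefined fun κ hκ o => ?_
  rw [classicalInput_tensor_iff] at hκ
  obtain ⟨K₁, t₁, hC₁⟩ := h₁.exists_completes hκ.1 o
  obtain ⟨K₂, t₂, hC₂⟩ := h₂.exists_completes hκ.2 o
  refine ⟨_, _, hC₁.tensor hC₂, ?_⟩
  rintro (a | a) r hr
  · exact hC₁.isSome_mem h₁ hr
  · exact hC₂.isSome_mem h₂ hr

/-- Every branch of the juxtaposition consists of a branch of each network. -/
theorem ParComposable.completes (hc : ParComposable N₁ N₂) {o₁ o₂ : Finset Q}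
    (ho₁ : o₁ ∈ N₁.meas.powerset) (ho₂ : o₂ ∈ N₂.meas.powerset)
    (hC₁ : N₁.Completes κ₁ o₁ K₁ t₁) (hC₂ : N₂.Completes κ₂ o₂ K₂ t₂) :
    (N₁.tensor N₂).Completes (Sum.elim κ₁ κ₂) (o₁ ∪ o₂) (K₂ * K₁) (Sum.elim t₁ t₂) := by
  rw [Finset.mem_powerset] at ho₁ ho₂
  have hd := Finset.disjoint_left.1 hc.disjoint_meas
  refine Completes.tensor (hC₁.congr_outcomes fun x hx => ?_)
    (hC₂.congr_outcomes fun x hx => ?_)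
  · rw [Finset.mem_union]
    exact ⟨.inl, fun h => h.resolve_right fun h => hd hx (ho₂ h)⟩
  · rw [Finset.mem_union]
    exact ⟨.inr, fun h => h.resolve_left fun h => hd (ho₁ h) hx⟩

/-- On a product of inputs, each network acts on its own input and resource. -/
theorem ParComposable.conj_tensor (hc : ParComposable N₁ N₂) (h₁ : N₁.WellDefined)
    (h₂ : N₂.WellDefined) {o₁ o₂ : Finset Q} (hC₁ : N₁.Completes κ₁ o₁ K₁ t₁)
    (hC₂ : N₂.Completes κ₂ o₂ K₂ t₂) (ρ₁ ρ₂ : QOp Q) :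
    K₂ * K₁ * DMC.tensor (N₁.tensor N₂).inReg (N₁.tensor N₂).res
        (DMC.tensor N₁.inReg N₂.inReg ρ₁ ρ₂) (N₁.tensor N₂).σ * (K₂ * K₁)ᴴ =
      DMC.tensor N₁.outReg N₂.outReg
        (K₁ * DMC.tensor N₁.inReg N₁.res ρ₁ N₁.σ * K₁ᴴ)
        (K₂ * DMC.tensor N₂.inReg N₂.res ρ₂ N₂.σ * K₂ᴴ) := by
  rw [hc.tensor_inReg h₁ h₂]
  simp only [tensor]
  rw [tensor_tensor_tensor_comm]
  exact DMC.conj_tensor hC₁.localOn hC₂.localOn hc.names_disjoint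
    (Finset.union_subset N₁.inReg_subset_names h₁.static.res_subset_names)
    h₁.outReg_subset_names
    (Finset.union_subset N₂.inReg_subset_names h₂.static.res_subset_names)
    h₂.outReg_subset_names (hC₁.carries h₁) (hC₂.carries h₂)
    (isOpFromTo_tensor _ _ _ _) (isOpFromTo_tensor _ _ _ _)

theorem ParComposable.ops_eq (hc : ParComposable N₁ N₂) (h₁ : N₁.WellDefined)
    (h₂ : N₂.WellDefined) {s₁ : PState A₁ Q X} {s₂ : PState A₂ Q X} (hs₁ : N₁.IsInput s₁)
    (hs₂ : N₂.IsInput s₂) : (N₁.tensor N₂).ops (stateTensor N₁.inReg N₂.inReg s₁ s₂) =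
      distTensor N₁.outReg N₂.outReg (N₁.ops s₁) (N₂.ops s₂) := by
  obtain ⟨κ₁, ρ₁⟩ := s₁
  obtain ⟨κ₂, ρ₂⟩ := s₂
  obtain ⟨hκ₁, hρ₁⟩ := hs₁
  obtain ⟨hκ₂, hρ₂⟩ := hs₂
  have hd₁ := hρ₁.tensor N₁.disjoint_inReg_res h₁.density
  have hd₂ := hρ₂.tensor N₂.disjoint_inReg_res h₂.density
  have h := hc.wellDefined h₁ h₂
  choose K₁ t₁ hC₁ using fun o => h₁.exists_completes hκ₁ o
  choose K₂ t₂ hC₂ using fun o => h₂.exists_completes hκ₂ o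
  choose K t ht using fun o => h.exists_completes (κ := Sum.elim κ₁ κ₂)
    (classicalInput_tensor_iff.2 ⟨hκ₁, hκ₂⟩) o
  have hρ : IsDensity (N₁.tensor N₂).inReg (DMC.tensor N₁.inReg N₂.inReg ρ₁ ρ₂) := by
    rw [hc.tensor_inReg h₁ h₂]
    exact hρ₁.tensor (hc.names_disjoint.mono N₁.inReg_subset_names N₂.inReg_subset_names) hρ₂
  rw [h₁.ops_eq (fun o _ => hC₁ o) hρ₁, h₂.ops_eq (fun o _ => hC₂ o) hρ₂, distTensor_sum,
    stateTensor, h.ops_eq (fun o _ => ht o) hρ, tensor_meas, sum_powerset_union hc.disjoint_meas]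
  refine Finset.sum_congr rfl fun o₁ ho₁ => Finset.sum_congr rfl fun o₂ ho₂ => ?_
  obtain ⟨et, eK⟩ := (hc.completes ho₁ ho₂ (hC₁ o₁) (hC₂ o₂)).unique h (ht (o₁ ∪ o₂))
  rw [et, eK, output_tensor, hc.conj_tensor h₁ h₂ (hC₁ o₁) (hC₂ o₂),
    distTensor_weightedPoint
      (hc.names_disjoint.mono h₁.outReg_subset_names h₂.outReg_subset_names) _ _
      (hd₁.1.mul_mul_conjTranspose_same _) (hd₂.1.mul_mul_conjTranspose_same _)
      (((hC₁ o₁).carries h₁).conj_isOpFromTo hd₁.2.2)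
      (((hC₂ o₂).carries h₂).conj_isOpFromTo hd₂.2.2)]

/-- The map of the juxtaposition on products.  Here `ρ₁` and `ρ₂` are arbitrary operators, not only
density operators. -/
theorem ParComposable.den_tensor (hc : ParComposable N₁ N₂) (h₁ : N₁.WellDefined)
    (h₂ : N₂.WellDefined) (κ₁ κ₁' : A₁ → Mem Q X) (κ₂ κ₂' : A₂ → Mem Q X) (ρ₁ ρ₂ : QOp Q) :
    (N₁.tensor N₂).den (Sum.elim κ₁ κ₂) (Sum.elim κ₁' κ₂')
        (DMC.tensor N₁.inReg N₂.inReg ρ₁ ρ₂) =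
      DMC.tensor N₁.outReg N₂.outReg (N₁.den κ₁ κ₁' ρ₁) (N₂.den κ₂ κ₂' ρ₂) := by
  classical
  by_cases hκ : N₁.ClassicalInput κ₁ ∧ N₂.ClassicalInput κ₂
  swap
  · rw [den_eq_zero (N := N₁.tensor N₂) fun h =>
      hκ (classicalInput_tensor_iff (κ := Sum.elim κ₁ κ₂).1 h),
      LinearMap.zero_apply]
    rcases not_and_or.1 hκ with hκ | hκ
    · rw [den_eq_zero hκ, LinearMap.zero_apply, tensor_zero_left]
    · rw [den_eq_zero hκ, LinearMap.zero_apply, tensor_comm, tensor_zero_left]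
  choose K₁ t₁ hC₁ using fun o => h₁.exists_completes hκ.1 o
  choose K₂ t₂ hC₂ using fun o => h₂.exists_completes hκ.2 o
  rw [den_apply, den_apply, den_apply, tensor_meas, sum_powerset_union hc.disjoint_meas,
    tensor_sum_left]
  refine Finset.sum_congr rfl fun o₁ ho₁ => ?_
  rw [tensor_sum_right]
  refine Finset.sum_congr rfl fun o₂ ho₂ => ?_
  have hout : Sum.elim κ₁' κ₂' = (N₁.tensor N₂).output (Sum.elim (t₁ o₁) (t₂ o₂)) ↔
      κ₁' = N₁.output (t₁ o₁) ∧ κ₂' = N₂.output (t₂ o₂) := by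
    rw [output_tensor]
    refine ⟨fun h => ⟨funext fun a => congrFun h (Sum.inl a), funext fun a =>
      congrFun h (Sum.inr a)⟩, ?_⟩
    rintro ⟨rfl, rfl⟩
    rfl
  rw [(hc.completes ho₁ ho₂ (hC₁ o₁) (hC₂ o₂)).branchOp_eq (hc.wellDefined h₁ h₂),
    (hC₁ o₁).branchOp_eq h₁, (hC₂ o₂).branchOp_eq h₂]
  by_cases e₁ : κ₁' = N₁.output (t₁ o₁)
  · by_cases e₂ : κ₂' = N₂.output (t₂ o₂)
    · rw [if_pos (hout.2 ⟨e₁, e₂⟩), if_pos e₁, if_pos e₂]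
      exact hc.conj_tensor h₁ h₂ (hC₁ o₁) (hC₂ o₂) ρ₁ ρ₂
    · rw [if_neg fun h => e₂ (hout.1 h).2, if_neg e₂, tensor_comm N₁.outReg]
      simp [tensor_zero_left]
  · rw [if_neg fun h => e₁ (hout.1 h).1, if_neg e₁]
    simp [tensor_zero_left]

theorem ParComposable.den_eq (hc : ParComposable N₁ N₂) (h₁ : N₁.WellDefined)
    (h₂ : N₂.WellDefined) (κ₁ κ₁' : A₁ → Mem Q X) (κ₂ κ₂' : A₂ → Mem Q X) (ρ : QOp Q) :
    (N₁.tensor N₂).den (Sum.elim κ₁ κ₂) (Sum.elim κ₁' κ₂') ρ =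
      mapTensor N₁.inReg N₁.outReg N₂.inReg N₂.outReg (N₁.den κ₁ κ₁') (N₂.den κ₂ κ₂') ρ := by
  have hd := hc.names_disjoint.mono N₁.inReg_subset_names N₂.inReg_subset_names
  -- Only the entries of `ρ` on the input register matter, and there `ρ` is a combination of
  -- products of matrix units.
  have hρ : (N₁.tensor N₂).den (Sum.elim κ₁ κ₂) (Sum.elim κ₁' κ₂') ρ =
      (N₁.tensor N₂).den (Sum.elim κ₁ κ₂) (Sum.elim κ₁' κ₂')
        (∑ b₁ ∈ N₁.inReg.powerset, ∑ c₁ ∈ N₁.inReg.powerset, ∑ b₂ ∈ N₂.inReg.powerset,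
          ∑ c₂ ∈ N₂.inReg.powerset, ρ (b₁ ∪ b₂) (c₁ ∪ c₂) • DMC.tensor N₁.inReg N₂.inReg
            (Matrix.single b₁ c₁ 1) (Matrix.single b₂ c₂ 1)) := by
    rw [den_apply, den_apply, hc.tensor_inReg h₁ h₂, tensor_congr_left fun b hb c hc =>
      (sum_smul_tensor_single hd ρ hb hc).symm]
  rw [hρ]
  simp only [map_sum, map_smul, hc.den_tensor h₁ h₂, mapTensor]

end Parallel

end Network
end DMC

theorem mainTheorem2 {A A₁ A₂ Q X Ch : Type*}
    [Fintype A] [DecidableEq A] [Fintype A₁] [DecidableEq A₁] [Fintype A₂] [DecidableEq A₂]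
    [Fintype Q] [DecidableEq Q] [Fintype X] [DecidableEq X] :
    (∀ N₁ N₂ : DMC.Network A Q X Ch, N₁.WellDefined → N₂.WellDefined →
      DMC.Network.SeqComposable N₁ N₂ →
        (N₂.comp N₁).WellDefined ∧
        (N₂.comp N₁).sig = N₂.sig.comp N₁.sig ∧
        (N₂.comp N₁).ops = DMC.ptsComp N₂.ops N₁.ops ∧
        (∀ κ κ'', (N₂.comp N₁).den κ κ'' = ∑ κ', N₂.den κ' κ'' ∘ₗ N₁.den κ κ') ∧
        (∀ κ κ'', DMC.IsCPM N₁.inReg N₂.outReg ((N₂.comp N₁).den κ κ''))) ∧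
    (∀ (N₁ : DMC.Network A₁ Q X Ch) (N₂ : DMC.Network A₂ Q X Ch),
      N₁.WellDefined → N₂.WellDefined → DMC.Network.ParComposable N₁ N₂ →
        (N₁.tensor N₂).WellDefined ∧
        (N₁.tensor N₂).sig = N₁.sig.tensor N₂.sig ∧
        (∀ s₁ s₂, N₁.IsInput s₁ → N₂.IsInput s₂ →
          (N₁.tensor N₂).ops (DMC.stateTensor N₁.inReg N₂.inReg s₁ s₂) =
            DMC.distTensor N₁.outReg N₂.outReg (N₁.ops s₁) (N₂.ops s₂)) ∧
        (∀ κ₁ κ₁' κ₂ κ₂' ρ,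
          (N₁.tensor N₂).den (Sum.elim κ₁ κ₂) (Sum.elim κ₁' κ₂') ρ =
            DMC.mapTensor N₁.inReg N₁.outReg N₂.inReg N₂.outReg
              (N₁.den κ₁ κ₁') (N₂.den κ₂ κ₂') ρ) ∧
        (∀ κ κ', DMC.IsCPM (N₁.inReg ∪ N₂.inReg) (N₁.outReg ∪ N₂.outReg)
          ((N₁.tensor N₂).den κ κ'))) := by
  refine ⟨fun N₁ N₂ h₁ h₂ hc => ⟨hc.wellDefined h₁ h₂, hc.sig_eq h₁ h₂, hc.ops_eq h₁ h₂,
    hc.den_eq h₁ h₂, fun κ κ'' => ?_⟩, fun N₁ N₂ h₁ h₂ hc => ⟨hc.wellDefined h₁ h₂,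
    hc.sig_eq h₁ h₂, fun _ _ => hc.ops_eq h₁ h₂, hc.den_eq h₁ h₂, fun κ κ' => ?_⟩⟩
  · have h := (hc.wellDefined h₁ h₂).isCPM_den κ κ''
    rwa [hc.comp_inReg h₁ h₂, hc.comp_outReg h₁ h₂] at h
  · have h := (hc.wellDefined h₁ h₂).isCPM_den κ κ'
    rwa [hc.tensor_inReg h₁ h₂, DMC.Network.tensor_outReg] at h
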